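/- Let $n\ge 1$, $r>0$ and $\mathfrak B_r=\{x\in\mathbb R^n:|x|<r\}$. For a bounded domain (bounded, open, connected set) $\Omega\subset\mathbb R^n$ put $$\lambda^D_{1,\infty}(\Omega)=\inf\{\|\nabla u\|_{L^\infty(\Omega)} : u\in W^{1,\infty}_0(\Omega),\ \|u\|_{L^\infty(\Omega)}=1\},$$ $$\lambda^N_{1,\infty}(\Omega)=\inf\{\|\nabla u\|_{L^\infty(\Omega)} : u\in W^{1,\infty}(\Omega),\ \sup_\Omega u=-\inf_\Omega u=1\},$$ where elements of $W^{1,\infty}(\Omega)$ are identified with their continuous representatives and $W^{1,\infty}_0(\Omega)$ consists of those that extend continuously to $\overline\Omega$ with value $0$ on $\partial\Omega$. A normalized Dirichlet $\infty$-eigenfunction on $\Omega$ is a function $u\in C(\overline\Omega)$ with $\|u\|_{L^\infty(\Omega)}=1$, $u=0$ on $\partial\Omega$, and $$\min\{-\Delta_\infty u,\ |\nabla u|-\lambda^D_{1,\infty}(\Omega)\,u\}=0\quad\text{in }\Omega$$ in the viscosity sense, where $\Delta_\infty u=(\nabla u)^TD^2u\,\nabla u$. Let $(\Omega_k)_{k\in\mathbb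 N}$ be bounded domains with $\mathscr L^n(\Omega_k)=\mathscr L^n(\mathfrak B_r)$, and for each $k$ let $u_k$ be a normalized Dirichlet $\infty$-eigenfunction on $\Omega_k$. Suppose that, as $k\to\infty$, $$|\lambda^D_{1,\infty}(\Omega_k)-\lambda^D_{1,\infty}(\mathfrak B_r)|\to0\quad\text{and}\quad|\lambda^N_{1,\infty}(\Omega_k)-\lambda^N_{1,\infty}(\mathfrak B_r)|\to0 .$$ Then, up to translations, $u_k$ converges locally uniformly in $\mathfrak B_r$ to the cone $v_\infty(x)=1-|x|/r$, which is the unique normalized Dirichlet $\infty$-eigenfunction on $\mathfrak B_r$. Precisely: there are points $x_k\in\mathbb R^n$ such that the Hausdorff distance between $\Omega_k$ and the ball $x_k+\mathfrak B_r$ tends to $0$; and for every such sequence $(x_k)$ and every compact $K\subset\mathfrak B_r$ one has $x_k+K\subset\Omega_k$ for all large $k$, and $$\sup_{y\in K}|u_k(x_k+y)-v_\infty(y)|\to0 .$$ (In particular, if $\Omega_k\to\mathfrak B_r$ in Hausdorff distance, then $u_k\to v_\infty$ locally uniformly in $\mathfrak B_r$.) -/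

import Mathlib

open MeasureTheory Filter Topology

noncomputable section

namespace InfEigen

/-- A bounded domain: a bounded, open, connected (in particular nonempty) subset of `ℝⁿ`. -/
structure IsBoundedDomain {n : ℕ} (Ω : Set (EuclideanSpace ℝ (Fin n))) : Prop where
  isOpen : IsOpen Ω
  isConnected : IsConnected Ω
  isBounded : Bornology.IsBounded Ω

/-- `g` is the weak (distributional) gradient of `u` in the open set `Ω`:
`∫_Ω u ∂_v φ = - ∫_Ω ⟨g, v⟩ φ` for every `φ ∈ C_c^∞(Ω)` and every direction `v`. -/
def IsWeakGradient {n : ℕ} (Ω : Set (EuclideanSpace ℝ (Fin n)))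
    (u : EuclideanSpace ℝ (Fin n) → ℝ)
    (g : EuclideanSpace ℝ (Fin n) → EuclideanSpace ℝ (Fin n)) : Prop :=
  ∀ φ : EuclideanSpace ℝ (Fin n) → ℝ, ContDiff ℝ ((⊤ : ℕ∞) : WithTop ℕ∞) φ →
    HasCompactSupport φ → tsupport φ ⊆ Ω → ∀ v : EuclideanSpace ℝ (Fin n),
      ∫ x in Ω, u x * fderiv ℝ φ x v = - ∫ x in Ω, inner ℝ (g x) v * φ x

/-- `u ∈ W^{1,∞}(Ω)` with weak gradient `g`. Elements of `W^{1,∞}(Ω)` are (locally Lipschitz)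
continuous in `Ω` after modification on a null set; `u` is this continuous representative. -/
structure MemW1Infty {n : ℕ} (Ω : Set (EuclideanSpace ℝ (Fin n)))
    (u : EuclideanSpace ℝ (Fin n) → ℝ)
    (g : EuclideanSpace ℝ (Fin n) → EuclideanSpace ℝ (Fin n)) : Prop where
  continuousOn : ContinuousOn u Ω
  memLp : MemLp u ⊤ (volume.restrict Ω)
  memLp_grad : MemLp g ⊤ (volume.restrict Ω)
  isWeakGradient : IsWeakGradient Ω u g

/-- `u ∈ W^{1,∞}_0(Ω)` with weak gradient `g`: the function `u` belongs to `W^{1,∞}(Ω)`, is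
continuous up to the boundary and vanishes there. -/
structure MemW1InftyZero {n : ℕ} (Ω : Set (EuclideanSpace ℝ (Fin n)))
    (u : EuclideanSpace ℝ (Fin n) → ℝ)
    (g : EuclideanSpace ℝ (Fin n) → EuclideanSpace ℝ (Fin n)) : Prop where
  memW : MemW1Infty Ω u g
  continuousOn_closure : ContinuousOn u (closure Ω)
  eq_zero : ∀ x ∈ frontier Ω, u x = 0

/-- The first Dirichlet `∞`-eigenvalue: the infimum of `‖∇u‖_{L^∞(Ω)}` over all
`u ∈ W^{1,∞}_0(Ω)` with `‖u‖_{L^∞(Ω)} = 1`. -/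
def dirichletEigenvalue {n : ℕ} (Ω : Set (EuclideanSpace ℝ (Fin n))) : ℝ :=
  sInf {t : ℝ | ∃ (u : EuclideanSpace ℝ (Fin n) → ℝ)
    (g : EuclideanSpace ℝ (Fin n) → EuclideanSpace ℝ (Fin n)),
    MemW1InftyZero Ω u g ∧ eLpNorm u ⊤ (volume.restrict Ω) = 1 ∧
      t = (eLpNorm g ⊤ (volume.restrict Ω)).toReal}

/-- The first nontrivial Neumann `∞`-eigenvalue: the infimum of `‖∇u‖_{L^∞(Ω)}` over all
`u ∈ W^{1,∞}(Ω)` with `sup_Ω u = 1` and `inf_Ω u = -1`. -/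
def neumannEigenvalue {n : ℕ} (Ω : Set (EuclideanSpace ℝ (Fin n))) : ℝ :=
  sInf {t : ℝ | ∃ (u : EuclideanSpace ℝ (Fin n) → ℝ)
    (g : EuclideanSpace ℝ (Fin n) → EuclideanSpace ℝ (Fin n)),
    MemW1Infty Ω u g ∧ IsLUB (u '' Ω) 1 ∧ IsGLB (u '' Ω) (-1) ∧
      t = (eLpNorm g ⊤ (volume.restrict Ω)).toReal}

/-- The `∞`-Laplacian `Δ_∞ φ (x) = ∇φ(x)ᵀ D²φ(x) ∇φ(x)`. -/
def infLaplacian {n : ℕ} (φ : EuclideanSpace ℝ (Fin n) → ℝ)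
    (x : EuclideanSpace ℝ (Fin n)) : ℝ :=
  fderiv ℝ (fderiv ℝ φ) x (gradient φ x) (gradient φ x)

/-- `u` is a viscosity subsolution of `min {-Δ_∞ u, |∇u| - Λ u} = 0` in `Ω`. -/
def IsViscositySubsolution {n : ℕ} (Λ : ℝ) (Ω : Set (EuclideanSpace ℝ (Fin n)))
    (u : EuclideanSpace ℝ (Fin n) → ℝ) : Prop :=
  ∀ x ∈ Ω, ∀ φ : EuclideanSpace ℝ (Fin n) → ℝ, ContDiffAt ℝ 2 φ x →
    IsLocalMax (fun y => u y - φ y) x →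
      min (-infLaplacian φ x) (‖gradient φ x‖ - Λ * u x) ≤ 0

/-- `u` is a viscosity supersolution of `min {-Δ_∞ u, |∇u| - Λ u} = 0` in `Ω`. -/
def IsViscositySupersolution {n : ℕ} (Λ : ℝ) (Ω : Set (EuclideanSpace ℝ (Fin n)))
    (u : EuclideanSpace ℝ (Fin n) → ℝ) : Prop :=
  ∀ x ∈ Ω, ∀ φ : EuclideanSpace ℝ (Fin n) → ℝ, ContDiffAt ℝ 2 φ x →
    IsLocalMin (fun y => u y - φ y) x →
      0 ≤ min (-infLaplacian φ x) (‖gradient φ x‖ - Λ * u x)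

/-- `u` is a normalized Dirichlet `∞`-eigenfunction (`∞`-ground state) on `Ω`: it is continuous on
the closure of `Ω`, solves `min {-Δ_∞ u, |∇u| - Λ u} = 0` in `Ω` in the viscosity sense, where `Λ`
is the first Dirichlet `∞`-eigenvalue of `Ω`, vanishes on the boundary, and
`‖u‖_{L^∞(Ω)} = 1`. Only the values of `u` on the closure of `Ω` matter. -/
structure IsNormalizedEigenfunction {n : ℕ} (Ω : Set (EuclideanSpace ℝ (Fin n)))
    (u : EuclideanSpace ℝ (Fin n) → ℝ) : Prop where
  continuousOn : ContinuousOn u (closure Ω)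
  subsolution : IsViscositySubsolution (dirichletEigenvalue Ω) Ω u
  supersolution : IsViscositySupersolution (dirichletEigenvalue Ω) Ω u
  eq_zero : ∀ x ∈ frontier Ω, u x = 0
  normalized : eLpNorm u ⊤ (volume.restrict Ω) = 1

/-- The cone `v_∞(x) = 1 - |x| / r`. -/
def cone {n : ℕ} (r : ℝ) (x : EuclideanSpace ℝ (Fin n)) : ℝ := 1 - ‖x‖ / r

end InfEigen

end

namespace InfEigen

/-! Each eigenvalue controls one radius. Let `Λ` be the Dirichlet eigenvalue of a domain. Its
eigenfunction lies below `Λ` times the distance to the complement (`le_mul_norm_sub`), by comparing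
the subsolution with cones whose vertex lies outside. At a point `c` with value 1 this puts the ball
of radius `1/Λ` around `c` inside the domain, and comparing the supersolution with cones gives `1 -
Λ|x - c|` as a lower bound there (`exists_center`).

Affine test functions show that the Neumann eigenvalue times the diameter is at most 2. A point far
from `c` would form too large a diameter with the opposite side of the inscribed ball
(`norm_sub_add_le_of_ball_subset`). For the ball of radius `r` the Dirichlet eigenvalue equals `1/r`
and the Neumann eigenvalue is at least `1/r`. Convergence of both therefore traps the domains
between balls around `c k` with radii tending to `r` (`isSqueezed_of_tendsto`).

The upper and lower bounds on `u k` then close up to the same cone. On the ball itself they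
coincide, which gives uniqueness. -/

/-! ### Lipschitz functions as elements of the Sobolev space -/

theorem ae_norm_le_toReal_eLpNorm_top {α F : Type*} [MeasurableSpace α] [NormedAddCommGroup F]
    {μ : Measure α} {f : α → F} (hf : MemLp f ⊤ μ) :
    ∀ᵐ x ∂μ, ‖f x‖ ≤ (eLpNorm f ⊤ μ).toReal := by
  have h := hf.eLpNorm_ne_top
  rw [eLpNorm_exponent_top] at h ⊢
  filter_upwards [ae_le_eLpNormEssSup (f := f) (μ := μ)] with x hx
  simpa using ENNReal.toReal_mono h hx

/-- Rademacher's theorem identifies the line derivatives with the gradient almost everywhere; the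
rest is integration by parts against a compactly supported Lipschitz function. -/
theorem isWeakGradient_gradient {n : ℕ} (Ω : Set (EuclideanSpace ℝ (Fin n)))
    {u : EuclideanSpace ℝ (Fin n) → ℝ} {C : NNReal} (hu : LipschitzWith C u) :
    IsWeakGradient Ω u (gradient u) := by
  intro φ hφ hc hs v
  obtain ⟨D, hD⟩ := (hφ.of_le (by exact_mod_cast le_top)).lipschitzWith_of_hasCompactSupport hc
    (n := 1) one_ne_zero
  have key := hu.integral_lineDeriv_mul_eq (μ := volume) hD hc v
  have hdφ : Differentiable ℝ φ := hφ.differentiable (by simp)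
  rw [setIntegral_eq_integral_of_forall_compl_eq_zero,
    setIntegral_eq_integral_of_forall_compl_eq_zero]
  · have h1 : ∫ x, inner ℝ (gradient u x) v * φ x = ∫ x, lineDeriv ℝ u x v * φ x := by
      refine integral_congr_ae ?_
      filter_upwards [hu.ae_differentiableAt (μ := volume)] with x hx
      rw [hx.lineDeriv_eq_fderiv, gradient, InnerProductSpace.toDual_symm_apply]
    rw [h1, key, ← integral_neg]
    refine integral_congr_ae (Eventually.of_forall fun x => ?_)
    simp only [(hdφ x).lineDeriv_eq_fderiv, map_neg]
    ring
  · intro x hx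
    rw [image_eq_zero_of_notMem_tsupport fun h => hx (hs h), mul_zero]
  · intro x hx
    have : x ∉ tsupport (fderiv ℝ φ) := fun h => hx (hs (tsupport_fderiv_subset ℝ h))
    rw [image_eq_zero_of_notMem_tsupport this]
    simp

theorem norm_gradient {n : ℕ} (u : EuclideanSpace ℝ (Fin n) → ℝ) (x : EuclideanSpace ℝ (Fin n)) :
    ‖gradient u x‖ = ‖fderiv ℝ u x‖ := by
  simp [gradient]

theorem norm_gradient_le {n : ℕ} {u : EuclideanSpace ℝ (Fin n) → ℝ} {C : NNReal}
    (hu : LipschitzWith C u) (x : EuclideanSpace ℝ (Fin n)) : ‖gradient u x‖ ≤ C := by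
  rw [norm_gradient]; exact norm_fderiv_le_of_lipschitz ℝ hu

theorem eLpNorm_gradient_le {n : ℕ} (Ω : Set (EuclideanSpace ℝ (Fin n)))
    {u : EuclideanSpace ℝ (Fin n) → ℝ} {C : NNReal} (hu : LipschitzWith C u) :
    (eLpNorm (gradient u) ⊤ (volume.restrict Ω)).toReal ≤ C := by
  rw [eLpNorm_exponent_top]
  have := eLpNormEssSup_le_of_ae_bound (μ := volume.restrict Ω)
    (Eventually.of_forall fun x => norm_gradient_le hu x)
  exact (ENNReal.toReal_mono (by simp) this).trans (by simp)

theorem memW1Infty_of_lipschitzWith {n : ℕ} {Ω : Set (EuclideanSpace ℝ (Fin n))}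
    (hΩ : IsOpen Ω) (hb : Bornology.IsBounded Ω)
    {u : EuclideanSpace ℝ (Fin n) → ℝ} {C : NNReal} (hu : LipschitzWith C u) :
    MemW1Infty Ω u (gradient u) where
  continuousOn := hu.continuous.continuousOn
  memLp := by
    obtain ⟨R, hR⟩ := (hb.isCompact_closure.image hu.continuous).isBounded.exists_norm_le
    refine memLp_top_of_bound hu.continuous.aestronglyMeasurable R ?_
    filter_upwards [ae_restrict_mem hΩ.measurableSet] with x hx
    exact hR _ ⟨x, subset_closure hx, rfl⟩
  memLp_grad := by
    refine memLp_top_of_bound ?_ C (Eventually.of_forall fun x => norm_gradient_le hu x)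
    exact ((InnerProductSpace.toDual ℝ
      (EuclideanSpace ℝ (Fin n))).symm.continuous.measurable.comp
        (measurable_fderiv ℝ u)).aestronglyMeasurable
  isWeakGradient := isWeakGradient_gradient Ω hu

/-! ### Mollification and pointwise bounds -/

open Convolution in
-- Since the closed ball lies in `Ω`, the translated kernel `z ↦ e (x - z)` is an admissible test
-- function. The derivative of the mollification is thus an average of `⟨g, v⟩` with weights of mass
-- at most one over `Ω`.
theorem norm_fderiv_mollify_le {n : ℕ} {Ω : Set (EuclideanSpace ℝ (Fin n))} (hΩ : IsOpen Ω)
    {u : EuclideanSpace ℝ (Fin n) → ℝ} {g : EuclideanSpace ℝ (Fin n) → EuclideanSpace ℝ (Fin n)}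
    (hu : MemW1Infty Ω u g) (hi : IntegrableOn u Ω)
    (η : ContDiffBump (0 : EuclideanSpace ℝ (Fin n))) {x : EuclideanSpace ℝ (Fin n)}
    (hx : Metric.closedBall x η.rOut ⊆ Ω) :
    ∃ f' : EuclideanSpace ℝ (Fin n) →L[ℝ] ℝ,
      HasFDerivAt (η.normed volume ⋆[ContinuousLinearMap.lsmul ℝ ℝ, volume] Ω.indicator u) f' x ∧
      ‖f'‖ ≤ (eLpNorm g ⊤ (volume.restrict Ω)).toReal := by
  set L := (eLpNorm g ⊤ (volume.restrict Ω)).toReal with hL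
  have hL0 : 0 ≤ L := ENNReal.toReal_nonneg
  set e := η.normed volume with he
  have hec : ContDiff ℝ ((⊤ : ℕ∞) : WithTop ℕ∞) e := η.contDiff_normed
  have hsup : HasCompactSupport e := η.hasCompactSupport_normed
  have hint : LocallyIntegrable (Ω.indicator u) volume :=
    ((integrable_indicator_iff hΩ.measurableSet).2 hi).locallyIntegrable
  have hec1 : ContDiff ℝ 1 e := hec.of_le (by exact_mod_cast le_top)
  have hd := hsup.hasFDerivAt_convolution_right (ContinuousLinearMap.lsmul ℝ ℝ).flip hint hec1 x
  rw [convolution_flip] at hd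
  refine ⟨_, hd, ContinuousLinearMap.opNorm_le_bound _ hL0 fun v => ?_⟩
  rw [convolution_precompR_apply _ hint (hsup.fderiv ℝ) (hec1.continuous_fderiv one_ne_zero)]
  set φ : EuclideanSpace ℝ (Fin n) → ℝ := fun z => e (x - z) with hφ
  have hφs : ContDiff ℝ ((⊤ : ℕ∞) : WithTop ℕ∞) φ := hec.comp (contDiff_const.sub contDiff_id)
  have hφt : tsupport φ ⊆ Metric.closedBall x η.rOut := by
    refine closure_minimal (fun z hz => ?_) Metric.isClosed_closedBall
    have : x - z ∈ Function.support e := hz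
    rw [he, η.support_normed_eq, mem_ball_zero_iff] at this
    rw [Metric.mem_closedBall, dist_comm, dist_eq_norm]
    exact this.le
  have hφc : HasCompactSupport φ :=
    (isCompact_closedBall x η.rOut).of_isClosed_subset (isClosed_tsupport φ) hφt
  -- This reflection sign cancels the minus sign in the definition of the weak gradient.
  have hder : ∀ z, fderiv ℝ φ z v = - fderiv ℝ e (x - z) v := by
    intro z
    have h1 : HasFDerivAt (fun z => x - z)
      (-ContinuousLinearMap.id ℝ (EuclideanSpace ℝ (Fin n))) z := (hasFDerivAt_id z).const_sub x
    have h2 := ((hec1.differentiable one_ne_zero (x - z)).hasFDerivAt.comp z h1).fderiv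
    have h3 : φ = e ∘ fun z => x - z := rfl
    rw [h3, h2]; simp
  have hkey := hu.isWeakGradient φ hφs hφc (hφt.trans hx) v
  have h1 : (Ω.indicator u ⋆[(ContinuousLinearMap.lsmul ℝ ℝ).flip, volume]
      fun a => fderiv ℝ e a v) x = ∫ z in Ω, inner ℝ (g z) v * φ z := by
    rw [← neg_neg (∫ z in Ω, inner ℝ (g z) v * φ z), ← hkey, ← integral_neg,
      ← integral_indicator hΩ.measurableSet]
    refine integral_congr_ae (Eventually.of_forall fun z => ?_)
    by_cases hz : z ∈ Ω
    · simp [hz, hder, mul_comm]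
    · simp [hz]
  rw [h1]
  have hφi : Integrable φ := hφs.continuous.integrable_of_hasCompactSupport hφc
  have h0 : ∀ z, 0 ≤ φ z := fun z => η.nonneg_normed _
  have hI : ∫ z, φ z = 1 := by
    rw [hφ, integral_sub_left_eq_self e volume x]; exact η.integral_normed
  calc ‖∫ z in Ω, inner ℝ (g z) v * φ z‖ ≤ ∫ z in Ω, L * ‖v‖ * φ z := by
        refine norm_integral_le_of_norm_le (hφi.integrableOn.const_mul _) ?_
        filter_upwards [ae_norm_le_toReal_eLpNorm_top hu.memLp_grad] with z hz
        rw [norm_mul, Real.norm_of_nonneg (h0 z)]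
        exact mul_le_mul_of_nonneg_right ((norm_inner_le_norm _ _).trans
          (mul_le_mul_of_nonneg_right hz (norm_nonneg _))) (h0 z)
    _ = L * ‖v‖ * ∫ z in Ω, φ z := integral_const_mul _ _
    _ ≤ L * ‖v‖ * 1 := by
        refine mul_le_mul_of_nonneg_left ?_ (by positivity)
        rw [← hI]
        exact setIntegral_le_integral hφi (Eventually.of_forall h0)
    _ = L * ‖v‖ := mul_one _

open Convolution in
-- Mollifications obey the mean value inequality on slightly smaller balls, and they converge
-- pointwise to `u`. Convexity of these balls gives the Euclidean distance with constant one.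
theorem MemW1Infty.abs_sub_le_of_mem_ball {n : ℕ} {r : ℝ}
    {u : EuclideanSpace ℝ (Fin n) → ℝ} {g : EuclideanSpace ℝ (Fin n) → EuclideanSpace ℝ (Fin n)}
    (hu : MemW1Infty (Metric.ball 0 r) u g) {x y : EuclideanSpace ℝ (Fin n)}
    (hx : x ∈ Metric.ball 0 r) (hy : y ∈ Metric.ball 0 r) :
    |u y - u x| ≤ (eLpNorm g ⊤ (volume.restrict (Metric.ball 0 r))).toReal * ‖y - x‖ := by
  set B := Metric.ball (0 : EuclideanSpace ℝ (Fin n)) r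
  have hB : IsOpen B := Metric.isOpen_ball
  have hi : IntegrableOn u B := by
    have : IsFiniteMeasure (volume.restrict B) :=
      ⟨by simpa [B] using measure_ball_lt_top⟩
    exact hu.memLp.integrable le_top
  let ε : ℕ → ℝ := fun i => 1 / ((i : ℝ) + 1)
  have hε : ∀ i, 0 < ε i := fun i => by positivity
  let η : ℕ → ContDiffBump (0 : EuclideanSpace ℝ (Fin n)) := fun i =>
    ⟨ε i / 2, ε i, half_pos (hε i), half_lt_self (hε i)⟩
  have hηr : Tendsto (fun i => (η i).rOut) atTop (𝓝 0) := tendsto_one_div_add_atTop_nhds_zero_nat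
  have hlim : ∀ z ∈ B, Tendsto (fun i => ((η i).normed volume
      ⋆[ContinuousLinearMap.lsmul ℝ ℝ, volume] B.indicator u) z) atTop (𝓝 (u z)) := by
    intro z hz
    refine ContDiffBump.convolution_tendsto_right hηr (Eventually.of_forall fun _ =>
      ((integrable_indicator_iff hB.measurableSet).2 hi).aestronglyMeasurable) ?_
      tendsto_const_nhds
    have h1 : Tendsto (B.indicator u) (𝓝 z) (𝓝 (u z)) := by
      refine ((hu.continuousOn.continuousAt (hB.mem_nhds hz)).tendsto).congr' ?_
      filter_upwards [hB.mem_nhds hz] with w hw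
      simp [hw]
    exact h1.comp tendsto_snd
  refine le_of_tendsto ((hlim y hy).sub (hlim x hx)).abs ?_
  have hxr : ‖x‖ < r := by simpa [B] using hx
  have hyr : ‖y‖ < r := by simpa [B] using hy
  filter_upwards [hηr.eventually (gt_mem_nhds (sub_pos.2 hxr)),
    hηr.eventually (gt_mem_nhds (sub_pos.2 hyr))] with i h1 h2
  have hsub : ∀ z ∈ Metric.ball (0 : EuclideanSpace ℝ (Fin n)) (r - (η i).rOut),
      Metric.closedBall z (η i).rOut ⊆ B := by
    intro z hz
    refine Metric.closedBall_subset_ball' ?_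
    rw [Metric.mem_ball] at hz
    linarith
  choose! f' hf' hf'L using fun z hz => norm_fderiv_mollify_le hB hu hi (η i) (hsub z hz)
  exact (convex_ball _ _).norm_image_sub_le_of_norm_hasFDerivWithin_le
    (fun z hz => (hf' z hz).hasFDerivWithinAt) hf'L
    (by rw [mem_ball_zero_iff]; linarith) (by rw [mem_ball_zero_iff]; linarith)

/-- By continuity the set where the bound fails is open, so if nonempty it would have positive
measure. -/
theorem abs_le_toReal_eLpNorm_top {n : ℕ} {Ω : Set (EuclideanSpace ℝ (Fin n))} (hΩ : IsOpen Ω)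
    {u : EuclideanSpace ℝ (Fin n) → ℝ} (hc : ContinuousOn u Ω)
    (hu : MemLp u ⊤ (volume.restrict Ω)) {x : EuclideanSpace ℝ (Fin n)} (hx : x ∈ Ω) :
    |u x| ≤ (eLpNorm u ⊤ (volume.restrict Ω)).toReal := by
  set c := (eLpNorm u ⊤ (volume.restrict Ω)).toReal
  by_contra! hlt
  have ho : IsOpen (Ω ∩ (fun y => |u y|) ⁻¹' Set.Ioi c) :=
    hc.abs.isOpen_inter_preimage hΩ isOpen_Ioi
  have hpos := ho.measure_pos volume ⟨x, hx, hlt⟩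
  refine hpos.ne' ?_
  have h := (ae_restrict_iff' hΩ.measurableSet).1 (ae_norm_le_toReal_eLpNorm_top hu)
  refine measure_mono_null (fun y hy => ?_) h
  have h2 : c < |u y| := hy.2
  simp only [Set.mem_compl_iff, Set.mem_ofPred_eq, not_forall, not_le]
  exact ⟨hy.1, h2⟩

/-! ### The cone and the Dirichlet eigenvalue of the ball -/

theorem lipschitzWith_cone {n : ℕ} {r : ℝ} (hr : 0 < r) :
    LipschitzWith (Real.toNNReal (1 / r)) (cone r : EuclideanSpace ℝ (Fin n) → ℝ) := by
  refine LipschitzWith.of_dist_le_mul fun x y => ?_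
  rw [Real.coe_toNNReal _ (by positivity), Real.dist_eq, dist_eq_norm]
  have : cone r x - cone r y = 1 / r * (‖y‖ - ‖x‖) := by simp only [cone]; ring
  rw [this, abs_mul, abs_of_pos (by positivity : (0 : ℝ) < 1 / r), norm_sub_rev]
  exact mul_le_mul_of_nonneg_left (abs_norm_sub_norm_le _ _) (by positivity)

theorem cone_mem_Icc {n : ℕ} {r : ℝ} (hr : 0 < r) {x : EuclideanSpace ℝ (Fin n)}
    (hx : x ∈ Metric.ball 0 r) : cone r x ∈ Set.Icc (0 : ℝ) 1 := by
  rw [mem_ball_zero_iff] at hx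
  have h1 : ‖x‖ / r ≤ 1 := (div_le_one hr).2 hx.le
  have h2 : 0 ≤ ‖x‖ / r := by positivity
  constructor <;> simp only [cone] <;> linarith

theorem eLpNorm_cone {n : ℕ} {r : ℝ} (hr : 0 < r) :
    eLpNorm (cone r : EuclideanSpace ℝ (Fin n) → ℝ) ⊤ (volume.restrict (Metric.ball 0 r)) = 1 := by
  have hm := memW1Infty_of_lipschitzWith (n := n) (Metric.isOpen_ball (x := 0) (ε := r))
    Metric.isBounded_ball (lipschitzWith_cone hr)
  apply le_antisymm
  · rw [eLpNorm_exponent_top]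
    have := eLpNormEssSup_le_of_ae_bound (C := 1)
      (f := (cone r : EuclideanSpace ℝ (Fin n) → ℝ)) (μ := volume.restrict (Metric.ball 0 r)) ?_
    · simpa using this
    filter_upwards [ae_restrict_mem Metric.isOpen_ball.measurableSet] with x hx
    have := cone_mem_Icc hr hx
    rw [Real.norm_of_nonneg this.1]
    exact this.2
  · have h := abs_le_toReal_eLpNorm_top Metric.isOpen_ball hm.continuousOn hm.memLp
      (Metric.mem_ball_self hr)
    have h0 : cone r (0 : EuclideanSpace ℝ (Fin n)) = 1 := by simp [cone]
    rw [h0, abs_one] at h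
    rwa [← ENNReal.ofReal_one, ENNReal.ofReal_le_iff_le_toReal hm.memLp.eLpNorm_ne_top]

theorem cone_eq_zero_of_mem_frontier {n : ℕ} {r : ℝ} (hr : 0 < r) {x : EuclideanSpace ℝ (Fin n)}
    (hx : x ∈ frontier (Metric.ball 0 r)) : cone r x = 0 := by
  have h : ‖x‖ = r := by simpa using Metric.frontier_ball_subset_sphere hx
  simp [cone, h, hr.ne']

theorem memW1InftyZero_cone {n : ℕ} {r : ℝ} (hr : 0 < r) :
    MemW1InftyZero (Metric.ball 0 r) (cone r : EuclideanSpace ℝ (Fin n) → ℝ)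
      (gradient (cone r)) where
  memW := memW1Infty_of_lipschitzWith Metric.isOpen_ball Metric.isBounded_ball
    (lipschitzWith_cone hr)
  continuousOn_closure := (lipschitzWith_cone hr).continuous.continuousOn
  eq_zero _ hx := cone_eq_zero_of_mem_frontier hr hx

theorem exists_unit_direction {n : ℕ} (hn : 1 ≤ n) (x : EuclideanSpace ℝ (Fin n)) :
    ∃ e : EuclideanSpace ℝ (Fin n), ‖e‖ = 1 ∧ x = ‖x‖ • e := by
  have : Nonempty (Fin n) := ⟨⟨0, hn⟩⟩
  by_cases h : x = 0
  · obtain ⟨e, he⟩ := exists_norm_eq (EuclideanSpace ℝ (Fin n)) zero_le_one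
    exact ⟨e, he, by simp [h]⟩
  · exact ⟨‖x‖⁻¹ • x, norm_smul_inv_norm h, by
      rw [smul_smul, mul_inv_cancel₀ (norm_ne_zero_iff.2 h), one_smul]⟩

theorem exists_norm_eq_and_dist_eq {n : ℕ} (hn : 1 ≤ n) {s : ℝ}
    {x : EuclideanSpace ℝ (Fin n)} (hx : ‖x‖ ≤ s) : ∃ y : EuclideanSpace ℝ (Fin n),
      ‖y‖ = s ∧ ‖x - y‖ = s - ‖x‖ := by
  obtain ⟨e, he1, hxe⟩ := exists_unit_direction hn x
  refine ⟨s • e, ?_, ?_⟩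
  · rw [norm_smul, he1, mul_one, Real.norm_of_nonneg ((norm_nonneg x).trans hx)]
  · have : x - s • e = -((s - ‖x‖) • e) := by
      conv_lhs => rw [hxe]
      rw [sub_smul, neg_sub]
    rw [this, norm_neg, norm_smul, he1, mul_one, Real.norm_of_nonneg (by linarith)]

/-- The Lipschitz bound extends to the closure, where it is used at the boundary point nearest to
`x`, a zero of `u`. -/
theorem MemW1InftyZero.abs_le_of_mem_ball {n : ℕ} (hn : 1 ≤ n) {r : ℝ} (hr : 0 < r)
    {u : EuclideanSpace ℝ (Fin n) → ℝ} {g : EuclideanSpace ℝ (Fin n) → EuclideanSpace ℝ (Fin n)}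
    (hu : MemW1InftyZero (Metric.ball 0 r) u g) {x : EuclideanSpace ℝ (Fin n)}
    (hx : x ∈ Metric.ball 0 r) :
    |u x| ≤ (eLpNorm g ⊤ (volume.restrict (Metric.ball 0 r))).toReal * r := by
  set L := (eLpNorm g ⊤ (volume.restrict (Metric.ball 0 r))).toReal
  have hxr : ‖x‖ < r := by simpa using hx
  obtain ⟨e, he, hxe⟩ := exists_norm_eq_and_dist_eq hn hxr.le
  have hcl : closure (Metric.ball (0 : EuclideanSpace ℝ (Fin n)) r) = Metric.closedBall 0 r :=
    closure_ball 0 hr.ne'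
  have hre : e ∈ closure (Metric.ball (0 : EuclideanSpace ℝ (Fin n)) r) := by
    simp [hcl, he]
  have h0 : u e = 0 := hu.eq_zero _ (by rw [frontier_ball _ hr.ne']; simp [he])
  have hle : ∀ y ∈ closure (Metric.ball (0 : EuclideanSpace ℝ (Fin n)) r),
      |u y - u x| ≤ L * ‖y - x‖ := by
    refine fun y hy => le_on_closure (s := Metric.ball (0 : EuclideanSpace ℝ (Fin n)) r)
      (f := fun y => |u y - u x|) (g := fun y => L * ‖y - x‖)
      (fun y hy => hu.memW.abs_sub_le_of_mem_ball hx hy)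
      (hu.continuousOn_closure.sub continuousOn_const).abs
      (by fun_prop) hy
  have h1 := hle _ hre
  rw [h0, zero_sub, abs_neg, norm_sub_rev, hxe] at h1
  exact h1.trans (mul_le_mul_of_nonneg_left (by linarith [norm_nonneg x]) ENNReal.toReal_nonneg)

theorem dirichletEigenvalue_ball {n : ℕ} (hn : 1 ≤ n) {r : ℝ} (hr : 0 < r) :
    dirichletEigenvalue (Metric.ball (0 : EuclideanSpace ℝ (Fin n)) r) = 1 / r := by
  have hmem : (eLpNorm (gradient (cone r : EuclideanSpace ℝ (Fin n) → ℝ)) ⊤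
      (volume.restrict (Metric.ball 0 r))).toReal ∈
      {t : ℝ | ∃ (u : EuclideanSpace ℝ (Fin n) → ℝ)
        (g : EuclideanSpace ℝ (Fin n) → EuclideanSpace ℝ (Fin n)),
        MemW1InftyZero (Metric.ball 0 r) u g ∧
        eLpNorm u ⊤ (volume.restrict (Metric.ball 0 r)) = 1 ∧
        t = (eLpNorm g ⊤ (volume.restrict (Metric.ball 0 r))).toReal} :=
    ⟨_, _, memW1InftyZero_cone hr, eLpNorm_cone hr, rfl⟩
  apply le_antisymm
  · refine (csInf_le ⟨0, ?_⟩ hmem).trans ?_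
    · rintro t ⟨u, g, -, -, rfl⟩
      exact ENNReal.toReal_nonneg
    · refine (eLpNorm_gradient_le _ (lipschitzWith_cone hr)).trans ?_
      rw [Real.coe_toNNReal _ (by positivity)]
  · refine le_csInf ⟨_, hmem⟩ ?_
    rintro t ⟨u, g, hu, h1, rfl⟩
    rw [div_le_iff₀ hr]
    set L := (eLpNorm g ⊤ (volume.restrict (Metric.ball 0 r))).toReal
    have : eLpNorm u ⊤ (volume.restrict (Metric.ball 0 r)) ≤ ENNReal.ofReal (L * r) := by
      rw [eLpNorm_exponent_top]
      refine eLpNormEssSup_le_of_ae_bound ?_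
      filter_upwards [ae_restrict_mem Metric.isOpen_ball.measurableSet] with x hx
      exact hu.abs_le_of_mem_ball hn hr hx
    rw [h1] at this
    exact ENNReal.one_le_ofReal.1 this

/-! ### The Neumann eigenvalue and the diameter -/

/-- The competitor is the linear function in the direction `b - a`, renormalized affinely to have
supremum 1 and infimum -1. Its original oscillation `M - m` is at least `‖b - a‖`. -/
theorem exists_admissible_neumann {n : ℕ} {Ω : Set (EuclideanSpace ℝ (Fin n))}
    (hΩ : IsOpen Ω) (hb : Bornology.IsBounded Ω) {a b : EuclideanSpace ℝ (Fin n)}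
    (ha : a ∈ Ω) (hb' : b ∈ Ω) (hab : a ≠ b) :
    ∃ (u : EuclideanSpace ℝ (Fin n) → ℝ)
      (g : EuclideanSpace ℝ (Fin n) → EuclideanSpace ℝ (Fin n)),
      MemW1Infty Ω u g ∧ IsLUB (u '' Ω) 1 ∧ IsGLB (u '' Ω) (-1) ∧
      (eLpNorm g ⊤ (volume.restrict Ω)).toReal ≤ 2 / ‖b - a‖ := by
  have hd : 0 < ‖b - a‖ := norm_pos_iff.2 (sub_ne_zero.2 hab.symm)
  set e := ‖b - a‖⁻¹ • (b - a) with he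
  have he1 : ‖e‖ = 1 := norm_smul_inv_norm (sub_ne_zero.2 hab.symm)
  let l : EuclideanSpace ℝ (Fin n) → ℝ := fun x => inner ℝ e x
  have hlab : l b - l a = ‖b - a‖ := by
    simp only [l, ← inner_sub_right]
    rw [he, inner_smul_left, real_inner_self_eq_norm_sq]
    simp only [conj_trivial]
    field_simp
  have hlip : ∀ x y, |l x - l y| ≤ ‖x - y‖ := fun x y => by
    simp only [l, ← inner_sub_right]
    simpa [he1] using abs_real_inner_le_norm e (x - y)
  have hlc : Continuous l := by fun_prop
  have hbd : Bornology.IsBounded (l '' Ω) :=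
    (hb.isCompact_closure.image hlc).isBounded.subset (Set.image_mono subset_closure)
  have hne : (l '' Ω).Nonempty := ⟨_, a, ha, rfl⟩
  have hM := isLUB_csSup hne hbd.bddAbove
  have hm := isGLB_csInf hne hbd.bddBelow
  set M := sSup (l '' Ω)
  set m := sInf (l '' Ω)
  have hMm : ‖b - a‖ ≤ M - m := by
    rw [← hlab]; exact sub_le_sub (hM.1 ⟨b, hb', rfl⟩) (hm.1 ⟨a, ha, rfl⟩)
  have hMm0 : 0 < M - m := hd.trans_le hMm
  let u : EuclideanSpace ℝ (Fin n) → ℝ := fun x => (2 * l x - M - m) / (M - m)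
  have hu : LipschitzWith (Real.toNNReal (2 / (M - m))) u := by
    refine LipschitzWith.of_dist_le_mul fun x y => ?_
    rw [Real.coe_toNNReal _ (by positivity), Real.dist_eq, dist_eq_norm]
    have : u x - u y = 2 / (M - m) * (l x - l y) := by simp only [u]; ring
    rw [this, abs_mul, abs_of_pos (by positivity : (0 : ℝ) < 2 / (M - m))]
    exact mul_le_mul_of_nonneg_left (hlip x y) (by positivity)
  refine ⟨u, _, memW1Infty_of_lipschitzWith hΩ hb hu, ⟨?_, ?_⟩, ⟨?_, ?_⟩, ?_⟩
  · rintro _ ⟨x, hx, rfl⟩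
    have := hM.1 ⟨x, hx, rfl⟩
    simp only [u]
    rw [div_le_one hMm0]; linarith
  · intro c hc
    have : M ≤ (c * (M - m) + M + m) / 2 := hM.2 (by
      rintro _ ⟨x, hx, rfl⟩
      have := hc ⟨x, hx, rfl⟩
      simp only [u] at this
      rw [div_le_iff₀ hMm0] at this; linarith)
    by_contra! h
    nlinarith
  · rintro _ ⟨x, hx, rfl⟩
    have := hm.1 ⟨x, hx, rfl⟩
    simp only [u]
    rw [le_div_iff₀ hMm0]; linarith
  · intro c hc
    have : (c * (M - m) + M + m) / 2 ≤ m := hm.2 (by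
      rintro _ ⟨x, hx, rfl⟩
      have := hc ⟨x, hx, rfl⟩
      simp only [u] at this
      rw [le_div_iff₀ hMm0] at this; linarith)
    by_contra! h
    nlinarith
  · refine (eLpNorm_gradient_le _ hu).trans ?_
    rw [Real.coe_toNNReal _ (by positivity)]
    exact div_le_div_of_nonneg_left zero_le_two hd hMm

theorem neumannEigenvalue_mul_norm_sub_le {n : ℕ} {Ω : Set (EuclideanSpace ℝ (Fin n))}
    (hΩ : IsOpen Ω) (hb : Bornology.IsBounded Ω) {a b : EuclideanSpace ℝ (Fin n)}
    (ha : a ∈ Ω) (hb' : b ∈ Ω) : neumannEigenvalue Ω * ‖b - a‖ ≤ 2 := by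
  by_cases hab : a = b
  · simp [hab]
  have hd : 0 < ‖b - a‖ := norm_pos_iff.2 (sub_ne_zero.2 (Ne.symm hab))
  obtain ⟨u, g, hu, h1, h2, h3⟩ := exists_admissible_neumann hΩ hb ha hb' hab
  rw [← le_div_iff₀ hd, neumannEigenvalue]
  refine le_trans (csInf_le ⟨0, ?_⟩ ⟨u, g, hu, h1, h2, rfl⟩) h3
  rintro t ⟨u, g, -, -, -, rfl⟩
  exact ENNReal.toReal_nonneg

/-- A competitor has oscillation 2 on a convex set of diameter `2r`. Only this inequality is needed
for the squeezing. -/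
theorem one_div_le_neumannEigenvalue_ball {n : ℕ} (hn : 1 ≤ n) {r : ℝ} (hr : 0 < r) :
    1 / r ≤ neumannEigenvalue (Metric.ball (0 : EuclideanSpace ℝ (Fin n)) r) := by
  have : Nonempty (Fin n) := ⟨⟨0, hn⟩⟩
  obtain ⟨b, hb⟩ := exists_norm_eq (EuclideanSpace ℝ (Fin n)) (half_pos hr).le
  have hb0 : (0 : EuclideanSpace ℝ (Fin n)) ≠ b := by
    rintro rfl
    rw [norm_zero] at hb; linarith
  -- This competitor makes the admissible set nonempty; otherwise `sInf` would take its default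
  -- value 0.
  obtain ⟨u, g, hu, h1, h2, -⟩ := exists_admissible_neumann Metric.isOpen_ball
    Metric.isBounded_ball (Metric.mem_ball_self hr) (b := b)
    (by rw [mem_ball_zero_iff]; linarith) hb0
  refine le_csInf ⟨_, u, g, hu, h1, h2, rfl⟩ ?_
  rintro t ⟨u, g, hu, h1, h2, rfl⟩
  set L := (eLpNorm g ⊤ (volume.restrict (Metric.ball 0 r))).toReal
  have hL : 0 ≤ L := ENNReal.toReal_nonneg
  have key : ∀ x ∈ Metric.ball (0 : EuclideanSpace ℝ (Fin n)) r,
      ∀ y ∈ Metric.ball (0 : EuclideanSpace ℝ (Fin n)) r, u x ≤ u y + L * (2 * r) := by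
    intro x hx y hy
    have h := (abs_le.1 (hu.abs_sub_le_of_mem_ball hy hx)).2
    rw [mem_ball_zero_iff] at hx hy
    have : ‖x - y‖ ≤ 2 * r := (norm_sub_le x y).trans (by linarith)
    have := mul_le_mul_of_nonneg_left this hL
    linarith
  have h3 : 1 ≤ -1 + L * (2 * r) := by
    have : 1 - L * (2 * r) ≤ -1 := h2.2 (by
      rintro _ ⟨y, hy, rfl⟩
      have : 1 ≤ u y + L * (2 * r) := h1.2 (by
        rintro _ ⟨x, hx, rfl⟩
        exact key x hx y hy)
      linarith)
    linarith
  rw [div_le_iff₀ hr]; linarith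

/-! ### Calculus along lines and radial profiles -/

theorem eventually_hasDerivAt_comp_line {n : ℕ} {φ : EuclideanSpace ℝ (Fin n) → ℝ}
    {x : EuclideanSpace ℝ (Fin n)} (hφ : ContDiffAt ℝ 2 φ x) (v : EuclideanSpace ℝ (Fin n)) :
    ∀ᶠ t : ℝ in 𝓝 0,
      HasDerivAt (fun t : ℝ => φ (x + t • v)) (fderiv ℝ φ (x + t • v) v) t := by
  have hc : Tendsto (fun t : ℝ => x + t • v) (𝓝 0) (𝓝 x) := by
    have : Continuous fun t : ℝ => x + t • v := by fun_prop
    simpa using this.tendsto 0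
  filter_upwards [hc.eventually (hφ.eventually (by simp))] with t ht
  have h1 : HasDerivAt (fun t : ℝ => x + t • v) v t := by
    simpa using ((hasDerivAt_id t).smul_const v).const_add x
  exact ((ht.differentiableAt two_ne_zero).hasFDerivAt).comp_hasDerivAt t h1

theorem hasDerivAt_fderiv_line {n : ℕ} {φ : EuclideanSpace ℝ (Fin n) → ℝ}
    {x : EuclideanSpace ℝ (Fin n)} (hφ : ContDiffAt ℝ 2 φ x) (v : EuclideanSpace ℝ (Fin n)) :
    HasDerivAt (fun t : ℝ => fderiv ℝ φ (x + t • v) v) (fderiv ℝ (fderiv ℝ φ) x v v) 0 := by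
  have h1 : HasDerivAt (fun t : ℝ => x + t • v) v 0 := by
    simpa using ((hasDerivAt_id (0 : ℝ)).smul_const v).const_add x
  have h2 : DifferentiableAt ℝ (fderiv ℝ φ) x :=
    (hφ.fderiv_right (m := 1) (by norm_num)).differentiableAt one_ne_zero
  have h3 : HasFDerivAt (fderiv ℝ φ) (fderiv ℝ (fderiv ℝ φ) x) (x + (0 : ℝ) • v) := by
    simpa using h2.hasFDerivAt
  have h4 := h3.comp_hasDerivAt (0 : ℝ) h1
  simpa using h4.clm_apply (hasDerivAt_const (0 : ℝ) v)

/-- The radial quadratic profile `A + a |y - z| + b |y - z|²`. -/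
noncomputable def radial {n : ℕ} (z : EuclideanSpace ℝ (Fin n)) (A a b : ℝ)
    (y : EuclideanSpace ℝ (Fin n)) : ℝ := A + a * ‖y - z‖ + b * ‖y - z‖ ^ 2

theorem cone_eq_radial {n : ℕ} (r : ℝ) :
    (cone r : EuclideanSpace ℝ (Fin n) → ℝ) = radial 0 1 (-(1 / r)) 0 := by
  ext x
  simp only [cone, radial, sub_zero]
  ring

section Radial

variable {n : ℕ} {z x : EuclideanSpace ℝ (Fin n)} (A a b : ℝ)

theorem contDiffAt_radial (hx : x ≠ z) : ContDiffAt ℝ 2 (radial z A a b) x := by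
  have h : ContDiffAt ℝ 2 (fun y => ‖y - z‖) x :=
    (contDiffAt_id.sub contDiffAt_const).norm ℝ (sub_ne_zero.2 hx)
  exact (contDiffAt_const.add (contDiffAt_const.mul h)).add (contDiffAt_const.mul (h.pow 2))

theorem gradient_radial (hx : x ≠ z) :
    gradient (radial z A a b) x = ((a + 2 * b * ‖x - z‖) / ‖x - z‖) • (x - z) := by
  have hs : ‖x - z‖ ≠ 0 := norm_ne_zero_iff.2 (sub_ne_zero.2 hx)
  have h1 : HasFDerivAt (fun y => ‖y - z‖ ^ 2) (2 • innerSL ℝ (x - z)) x := by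
    have := (hasStrictFDerivAt_norm_sq (x - z)).hasFDerivAt.comp x ((hasFDerivAt_id x).sub_const z)
    exact this.congr_fderiv (by ext; simp)
  have h2 : HasFDerivAt (fun y => ‖y - z‖) (‖x - z‖⁻¹ • innerSL ℝ (x - z)) x := by
    have h3 := h1.sqrt (by positivity)
    simp only [Real.sqrt_sq (norm_nonneg _)] at h3
    refine h3.congr_fderiv ?_
    ext v
    simp
    field_simp
  have h4 : HasFDerivAt (radial z A a b)
      (a • (‖x - z‖⁻¹ • innerSL ℝ (x - z)) + b • (2 • innerSL ℝ (x - z))) x :=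
    ((h2.const_mul a).const_add A).add (h1.const_mul b)
  apply HasGradientAt.gradient
  rw [hasGradientAt_iff_hasFDerivAt]
  refine h4.congr_fderiv ?_
  ext v
  simp
  field_simp

theorem norm_gradient_radial (hx : x ≠ z) :
    ‖gradient (radial z A a b) x‖ = |a + 2 * b * ‖x - z‖| := by
  have hs : ‖x - z‖ ≠ 0 := norm_ne_zero_iff.2 (sub_ne_zero.2 hx)
  rw [gradient_radial A a b hx, norm_smul, norm_div, norm_norm, Real.norm_eq_abs,
    div_mul_cancel₀ _ hs]

theorem radial_add_smul {t : ℝ} (ht : 0 ≤ ‖x - z‖ + t) (hx : x ≠ z) :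
    radial z A a b (x + t • (‖x - z‖⁻¹ • (x - z))) =
      A + a * (‖x - z‖ + t) + b * (‖x - z‖ + t) ^ 2 := by
  have hs : ‖x - z‖ ≠ 0 := norm_ne_zero_iff.2 (sub_ne_zero.2 hx)
  have : x + t • (‖x - z‖⁻¹ • (x - z)) - z = (‖x - z‖ + t) • (‖x - z‖⁻¹ • (x - z)) := by
    rw [add_smul, smul_smul ‖x - z‖, mul_inv_cancel₀ hs, one_smul]
    abel
  rw [radial, this, norm_smul, norm_smul, norm_inv, norm_norm, inv_mul_cancel₀ hs, mul_one,
    Real.norm_of_nonneg ht]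

theorem eventually_radial_add_smul (hx : x ≠ z) : ∀ᶠ t : ℝ in 𝓝 0,
    radial z A a b (x + t • (‖x - z‖⁻¹ • (x - z))) =
      A + a * (‖x - z‖ + t) + b * (‖x - z‖ + t) ^ 2 := by
  have hs : 0 < ‖x - z‖ := norm_pos_iff.2 (sub_ne_zero.2 hx)
  filter_upwards [lt_mem_nhds (neg_neg_of_pos hs)] with t ht
  exact radial_add_smul A a b (by linarith) hx

/-- The gradient is radial, so only the second derivative along the radial line, namely `2b`,
enters; the full Hessian is never computed. -/
theorem infLaplacian_radial (hx : x ≠ z) :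
    infLaplacian (radial z A a b) x = 2 * b * (a + 2 * b * ‖x - z‖) ^ 2 := by
  have hs : ‖x - z‖ ≠ 0 := norm_ne_zero_iff.2 (sub_ne_zero.2 hx)
  set e := ‖x - z‖⁻¹ • (x - z) with he
  have hg : gradient (radial z A a b) x = (a + 2 * b * ‖x - z‖) • e := by
    rw [gradient_radial A a b hx, he, smul_smul, div_eq_mul_inv]
  have hC := contDiffAt_radial A a b hx
  have h1 : ∀ᶠ t : ℝ in 𝓝 0,
      fderiv ℝ (radial z A a b) (x + t • e) e = a + 2 * b * (‖x - z‖ + t) := by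
    filter_upwards [eventually_hasDerivAt_comp_line hC e,
      (eventually_radial_add_smul A a b hx).eventually_nhds] with t h2 h3
    have h4 : HasDerivAt (fun t : ℝ => ‖x - z‖ + t) 1 t := (hasDerivAt_id t).const_add _
    have h5 := (((h4.const_mul a).const_add A).add ((h4.pow 2).const_mul b)).congr_of_eventuallyEq
      (f₁ := fun t : ℝ => radial z A a b (x + t • e)) h3
    rw [h2.unique h5]
    simp
    ring
  have h6 := (hasDerivAt_fderiv_line hC e).congr_of_eventuallyEq (EventuallyEq.symm h1)
  have h7 : HasDerivAt (fun t : ℝ => a + 2 * b * (‖x - z‖ + t)) (2 * b * 1) 0 :=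
    (((hasDerivAt_id (0 : ℝ)).const_add _).const_mul (2 * b)).const_add a
  have h8 : ∀ c : ℝ, fderiv ℝ (fderiv ℝ (radial z A a b)) x (c • e) (c • e) =
      c * (c * fderiv ℝ (fderiv ℝ (radial z A a b)) x e e) := by
    clear_value e
    intro c
    simp
  rw [infLaplacian, hg, h8, h6.unique h7]
  ring

end Radial

/-! ### Comparison with radial profiles -/

/-- Comparison of a supersolution with a strictly `∞`-subharmonic radial profile. -/
theorem IsViscositySupersolution.radial_le {n : ℕ} {Λ : ℝ}
    {Ω D : Set (EuclideanSpace ℝ (Fin n))} {u : EuclideanSpace ℝ (Fin n) → ℝ}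
    (hu : IsViscositySupersolution Λ Ω u) (hD : IsOpen D) (hb : Bornology.IsBounded D)
    (hDΩ : D ⊆ Ω) (hc : ContinuousOn u (closure D)) {z : EuclideanSpace ℝ (Fin n)} (hz : z ∉ D)
    {A a b : ℝ} (h0 : 0 < b) (hab : ∀ x ∈ D, a + 2 * b * ‖x - z‖ ≠ 0)
    (hf : ∀ x ∈ frontier D, radial z A a b x ≤ u x) {x : EuclideanSpace ℝ (Fin n)} (hx : x ∈ D) :
    radial z A a b x ≤ u x := by
  have hrc : Continuous (radial z A a b) := by unfold radial; fun_prop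
  obtain ⟨y, hy, hmin⟩ := hb.isCompact_closure.exists_isMinOn ⟨x, subset_closure hx⟩
    (hc.sub hrc.continuousOn)
  suffices h : radial z A a b y ≤ u y by
    have h1 : u y - radial z A a b y ≤ u x - radial z A a b x := hmin (subset_closure hx)
    linarith
  by_cases hyD : y ∈ D
  · exfalso
    have hyz : y ≠ z := fun h => hz (h ▸ hyD)
    have h1 := hu y (hDΩ hyD) _ (contDiffAt_radial A a b hyz)
      ((hmin.on_subset subset_closure).isLocalMin (hD.mem_nhds hyD))
    have h2 := h1.trans (min_le_left _ _)
    rw [infLaplacian_radial A a b hyz] at h2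
    have := hab y hyD
    have : 0 < 2 * b * (a + 2 * b * ‖y - z‖) ^ 2 := by positivity
    linarith
  · exact hf y (hD.frontier_eq ▸ ⟨hy, hyD⟩)

/-- Comparison of a subsolution with a strictly `∞`-superharmonic, steep radial profile. -/
theorem IsViscositySubsolution.le_radial {n : ℕ} {Λ : ℝ}
    {Ω : Set (EuclideanSpace ℝ (Fin n))} {u : EuclideanSpace ℝ (Fin n) → ℝ}
    (hu : IsViscositySubsolution Λ Ω u) (hΩ : IsOpen Ω) (hb : Bornology.IsBounded Ω)
    (hc : ContinuousOn u (closure Ω)) {z : EuclideanSpace ℝ (Fin n)} (hz : z ∉ Ω)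
    {A a b : ℝ} (h0 : b < 0) (hab : ∀ x ∈ Ω, a + 2 * b * ‖x - z‖ ≠ 0)
    (hsteep : ∀ x ∈ Ω, Λ * u x < |a + 2 * b * ‖x - z‖|)
    (hf : ∀ x ∈ frontier Ω, u x ≤ radial z A a b x) {x : EuclideanSpace ℝ (Fin n)} (hx : x ∈ Ω) :
    u x ≤ radial z A a b x := by
  have hrc : Continuous (radial z A a b) := by unfold radial; fun_prop
  obtain ⟨y, hy, hmax⟩ := hb.isCompact_closure.exists_isMaxOn ⟨x, subset_closure hx⟩
    (hc.sub hrc.continuousOn)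
  suffices h : u y ≤ radial z A a b y by
    have h1 : u x - radial z A a b x ≤ u y - radial z A a b y := hmax (subset_closure hx)
    linarith
  by_cases hyΩ : y ∈ Ω
  · exfalso
    have hyz : y ≠ z := fun h => hz (h ▸ hyΩ)
    have h1 := hu y hyΩ _ (contDiffAt_radial A a b hyz)
      ((hmax.on_subset subset_closure).isLocalMax (hΩ.mem_nhds hyΩ))
    rw [infLaplacian_radial A a b hyz, norm_gradient_radial A a b hyz] at h1
    have h2 : 0 < (a + 2 * b * ‖y - z‖) ^ 2 := by have := hab y hyΩ; positivity
    rcases min_le_iff.1 h1 with h | h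
    · nlinarith
    · linarith [hsteep y hyΩ]
  · exact hf y (hΩ.frontier_eq ▸ ⟨hy, hyΩ⟩)

/-- Compare with `b (|y - z|² - (2R + 1)²)`, which is nonpositive on the boundary, and let `b` tend
to 0. The vertex `z` has norm `R + 1` and so lies outside `Ω`. -/
theorem IsViscositySupersolution.nonneg {n : ℕ} (hn : 1 ≤ n) {Λ : ℝ}
    {Ω : Set (EuclideanSpace ℝ (Fin n))} {u : EuclideanSpace ℝ (Fin n) → ℝ}
    (hu : IsViscositySupersolution Λ Ω u) (hΩ : IsOpen Ω) (hb : Bornology.IsBounded Ω)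
    (hc : ContinuousOn u (closure Ω)) (h0 : ∀ x ∈ frontier Ω, u x = 0)
    {x : EuclideanSpace ℝ (Fin n)} (hx : x ∈ Ω) : 0 ≤ u x := by
  obtain ⟨R, hR⟩ := hb.closure.exists_norm_le
  have hR0 : 0 ≤ R := (norm_nonneg x).trans (hR x (subset_closure hx))
  obtain ⟨z, hzR, -⟩ := exists_norm_eq_and_dist_eq hn (s := R + 1)
    (x := (0 : EuclideanSpace ℝ (Fin n))) (by rw [norm_zero]; linarith)
  have hz : z ∉ Ω := fun h => by have := hR z (subset_closure h); linarith
  have key : ∀ᶠ b : ℝ in 𝓝[>] 0, radial z (-(b * (2 * R + 1) ^ 2)) 0 b x ≤ u x := by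
    filter_upwards [self_mem_nhdsWithin] with b hb0
    have hb0 : 0 < b := hb0
    refine hu.radial_le hΩ hb subset_rfl hc hz hb0 (fun y hy => ?_) (fun y hy => ?_) hx
    · have : 0 < ‖y - z‖ := norm_pos_iff.2 (sub_ne_zero.2 fun h => hz (h ▸ hy))
      positivity
    · rw [h0 y hy, radial]
      have h1 : ‖y - z‖ ≤ 2 * R + 1 :=
        (norm_sub_le _ _).trans (by linarith [hR y (frontier_subset_closure hy)])
      have h2 : ‖y - z‖ ^ 2 ≤ (2 * R + 1) ^ 2 := pow_le_pow_left₀ (norm_nonneg _) h1 2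
      nlinarith
  have hlim : Tendsto (fun b : ℝ => radial z (-(b * (2 * R + 1) ^ 2)) 0 b x) (𝓝[>] 0) (𝓝 0) := by
    have : Continuous fun b : ℝ => radial z (-(b * (2 * R + 1) ^ 2)) 0 b x := by
      unfold radial; fun_prop
    simpa [radial] using (this.tendsto 0).mono_left nhdsWithin_le_nhds
  exact le_of_tendsto hlim key

/-- The cone is `∞`-harmonic on the punctured ball, at most `u` at `c` and on the sphere. A small
convex quadratic term makes the comparison strict. -/
theorem IsViscositySupersolution.cone_le {n : ℕ} {Λ : ℝ}
    {Ω : Set (EuclideanSpace ℝ (Fin n))} {u : EuclideanSpace ℝ (Fin n) → ℝ}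
    (hu : IsViscositySupersolution Λ Ω u) (hc : ContinuousOn u (closure Ω))
    (h0 : ∀ x ∈ closure Ω, 0 ≤ u x) {c : EuclideanSpace ℝ (Fin n)} (hc1 : u c = 1) {d : ℝ}
    (hcd : Metric.ball c d ⊆ Ω) {x : EuclideanSpace ℝ (Fin n)} (hx : x ∈ Metric.ball c d) :
    1 - ‖x - c‖ / d ≤ u x := by
  have hd : 0 < d := Metric.pos_of_mem_ball hx
  by_cases hxc : x = c
  · simp [hxc, hc1]
  have hsub : closure (Metric.ball c d \ {c}) ⊆ closure (Metric.ball c d) :=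
    closure_mono Set.sdiff_subset
  have hD : IsOpen (Metric.ball c d \ {c}) := Metric.isOpen_ball.sdiff isClosed_singleton
  -- The slope correction `-b d` keeps the profile zero at distance `d`; taking `b < 1/d²` keeps it
  -- strictly decreasing inside the ball.
  have key : ∀ᶠ b : ℝ in 𝓝[>] 0, radial c 1 (-(1 / d) - b * d) b x ≤ u x := by
    have h1 : ∀ᶠ b : ℝ in 𝓝[>] 0, b < 1 / d ^ 2 :=
      nhdsWithin_le_nhds (gt_mem_nhds (by positivity))
    filter_upwards [self_mem_nhdsWithin, h1] with b hb0 hb1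
    have hb0 : 0 < b := hb0
    have hbd : b * d < 1 / d := by
      have := mul_lt_mul_of_pos_right hb1 hd
      rwa [show 1 / d ^ 2 * d = 1 / d by field_simp] at this
    refine hu.radial_le hD (Metric.isBounded_ball.subset Set.sdiff_subset)
      (Set.sdiff_subset.trans hcd) (hc.mono (hsub.trans (closure_mono hcd))) (by simp) hb0
      (fun y hy => ?_) (fun y hy => ?_) ⟨hx, hxc⟩
    · have : ‖y - c‖ < d := by simpa [dist_eq_norm] using hy.1
      have := mul_lt_mul_of_pos_left this hb0
      apply ne_of_lt
      linarith
    · rw [hD.frontier_eq] at hy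
      by_cases hyc : y = c
      · simp [hyc, radial, hc1]
      · have hycl := hsub hy.1
        have hyd : ‖y - c‖ = d := by
          apply le_antisymm
          · have := Metric.closure_ball_subset_closedBall hycl
            simpa [dist_eq_norm] using this
          · by_contra! h
            exact hy.2 ⟨by simpa [dist_eq_norm] using h, hyc⟩
        have : radial c 1 (-(1 / d) - b * d) b y = 0 := by
          rw [radial, hyd]; field_simp; ring
        rw [this]
        exact h0 y (closure_mono hcd hycl)
  have hlim : Tendsto (fun b : ℝ => radial c 1 (-(1 / d) - b * d) b x) (𝓝[>] 0)
      (𝓝 (1 - ‖x - c‖ / d)) := by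
    have : Continuous fun b : ℝ => radial c 1 (-(1 / d) - b * d) b x := by
      unfold radial; fun_prop
    have h := (this.tendsto 0).mono_left (nhdsWithin_le_nhds (s := Set.Ioi 0))
    have h2 : radial c 1 (-(1 / d) - 0 * d) 0 x = 1 - ‖x - c‖ / d := by
      rw [radial]; ring
    rwa [h2] at h
  exact le_of_tendsto hlim key

/-- Since `u ≤ 1`, a profile steeper than `Λ` and strictly `∞`-superharmonic violates both branches
of the minimum at an interior contact point. The slope excess `b (2D + 1)` absorbs the concave term,
as `D` bounds `|y - z|`. -/
theorem IsViscositySubsolution.le_mul_norm_sub {n : ℕ} {Λ : ℝ} (hΛ : 0 ≤ Λ)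
    {Ω : Set (EuclideanSpace ℝ (Fin n))} {u : EuclideanSpace ℝ (Fin n) → ℝ}
    (hu : IsViscositySubsolution Λ Ω u) (hΩ : IsOpen Ω) (hb : Bornology.IsBounded Ω)
    (hc : ContinuousOn u (closure Ω)) (h0 : ∀ x ∈ frontier Ω, u x = 0)
    (h1 : ∀ x ∈ Ω, u x ≤ 1) {x z : EuclideanSpace ℝ (Fin n)} (hx : x ∈ Ω) (hz : z ∉ Ω) :
    u x ≤ Λ * ‖x - z‖ := by
  obtain ⟨R, hR⟩ := hb.closure.exists_norm_le
  set D := R + ‖z‖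
  have hD : ∀ y ∈ closure Ω, ‖y - z‖ ≤ D := fun y hy =>
    (norm_sub_le _ _).trans (by linarith [hR y hy])
  have key : ∀ᶠ b : ℝ in 𝓝[>] 0, u x ≤ radial z 0 (Λ + b * (2 * D + 1)) (-b) x := by
    filter_upwards [self_mem_nhdsWithin] with b hb0
    have hb0 : 0 < b := hb0
    have hslope : ∀ y ∈ closure Ω, Λ < Λ + b * (2 * D + 1) + 2 * -b * ‖y - z‖ := by
      intro y hy
      nlinarith [hD y hy]
    refine hu.le_radial hΩ hb hc hz (neg_neg_of_pos hb0) (fun y hy => ?_) (fun y hy => ?_)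
      (fun y hy => ?_) hx
    · exact (hΛ.trans_lt (hslope y (subset_closure hy))).ne'
    · exact ((mul_le_of_le_one_right hΛ (h1 y hy)).trans_lt
        (hslope y (subset_closure hy))).trans_le (le_abs_self _)
    · have hy' := frontier_subset_closure hy
      have h2 : 0 ≤ (Λ + b * (2 * D + 1) - b * ‖y - z‖) * ‖y - z‖ := by
        refine mul_nonneg ?_ (norm_nonneg _)
        have := mul_nonneg hb0.le (norm_nonneg (y - z))
        linarith [hslope y hy']
      rw [h0 y hy, radial]
      linarith
  have hlim : Tendsto (fun b : ℝ => radial z 0 (Λ + b * (2 * D + 1)) (-b) x) (𝓝[>] 0)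
      (𝓝 (Λ * ‖x - z‖)) := by
    have : Continuous fun b : ℝ => radial z 0 (Λ + b * (2 * D + 1)) (-b) x := by
      unfold radial; fun_prop
    simpa [radial] using (this.tendsto 0).mono_left (nhdsWithin_le_nhds (s := Set.Ioi 0))
  exact ge_of_tendsto hlim key

/-! ### Contact of test functions; the cone as an eigenfunction -/

/-- If `h` has a local minimum at `0`, its second derivative there is nonnegative. -/
theorem second_deriv_nonneg_of_isLocalMin {h h' : ℝ → ℝ} {c : ℝ} (hmin : IsLocalMin h 0)
    (h1 : ∀ᶠ t in 𝓝 0, HasDerivAt h (h' t) t) (h2 : HasDerivAt h' c 0) : 0 ≤ c := by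
  by_contra! hc
  have hd : deriv h =ᶠ[𝓝 0] h' := h1.mono fun t ht => ht.deriv
  have hdd : deriv (deriv h) 0 = c := (h2.congr_of_eventuallyEq hd).deriv
  -- If `c < 0`, then 0 is also a local maximum, so `h` is locally constant and its second
  -- derivative vanishes.
  have hmax : IsLocalMax h 0 := isLocalMax_of_deriv_deriv_neg (by rwa [hdd]) hmin.deriv_eq_zero
    h1.self_of_nhds.continuousAt
  have hconst : h =ᶠ[𝓝 0] fun _ => h 0 := by
    filter_upwards [hmin, hmax] with t ha hb using le_antisymm hb ha
  have h0 : deriv h =ᶠ[𝓝 0] fun _ => 0 := by simpa using hconst.deriv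
  have := h0.deriv_eq
  rw [hdd, deriv_const] at this
  exact hc.ne this

theorem fderiv_fderiv_nonneg_of_isLocalMin {n : ℕ} {φ ψ : EuclideanSpace ℝ (Fin n) → ℝ}
    {x : EuclideanSpace ℝ (Fin n)} (hφ : ContDiffAt ℝ 2 φ x) (hψ : ContDiffAt ℝ 2 ψ x)
    (h : IsLocalMin (fun y => φ y - ψ y) x) (v : EuclideanSpace ℝ (Fin n)) :
    fderiv ℝ (fderiv ℝ ψ) x v v ≤ fderiv ℝ (fderiv ℝ φ) x v v := by
  have hc : Tendsto (fun t : ℝ => x + t • v) (𝓝 0) (𝓝 (x + (0 : ℝ) • v)) := by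
    have : Continuous fun t : ℝ => x + t • v := by fun_prop
    exact this.tendsto 0
  have hmin : IsLocalMin (fun t : ℝ => φ (x + t • v) - ψ (x + t • v)) 0 := by
    have hx : x + (0 : ℝ) • v = x := by simp
    rw [hx] at hc
    filter_upwards [hc.eventually h] with t ht
    simpa using ht
  refine sub_nonneg.1 (second_deriv_nonneg_of_isLocalMin hmin ?_
    ((hasDerivAt_fderiv_line hφ v).sub (hasDerivAt_fderiv_line hψ v)))
  filter_upwards [eventually_hasDerivAt_comp_line hφ v, eventually_hasDerivAt_comp_line hψ v]
    with t h1 h2 using h1.sub h2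

theorem gradient_eq_of_isLocalMin {n : ℕ} {φ ψ : EuclideanSpace ℝ (Fin n) → ℝ}
    {x : EuclideanSpace ℝ (Fin n)} (hφ : ContDiffAt ℝ 2 φ x) (hψ : ContDiffAt ℝ 2 ψ x)
    (h : IsLocalMin (fun y => φ y - ψ y) x) : gradient φ x = gradient ψ x := by
  have h1 := h.fderiv_eq_zero
  rw [fderiv_fun_sub (hφ.differentiableAt two_ne_zero) (hψ.differentiableAt two_ne_zero)] at h1
  rw [gradient, gradient, sub_eq_zero.1 h1]

theorem infLaplacian_le_of_isLocalMin {n : ℕ} {φ ψ : EuclideanSpace ℝ (Fin n) → ℝ}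
    {x : EuclideanSpace ℝ (Fin n)} (hφ : ContDiffAt ℝ 2 φ x) (hψ : ContDiffAt ℝ 2 ψ x)
    (h : IsLocalMin (fun y => φ y - ψ y) x) : infLaplacian ψ x ≤ infLaplacian φ x := by
  rw [infLaplacian, infLaplacian, gradient_eq_of_isLocalMin hφ hψ h]
  exact fderiv_fderiv_nonneg_of_isLocalMin hφ hψ h _

/-- If `φ` touches a cone with slope `-a` at its vertex from above, then `-a |v| ≤ ∂_v φ`. -/
theorem neg_mul_norm_le_fderiv {n : ℕ} {φ : EuclideanSpace ℝ (Fin n) → ℝ} {a : ℝ}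
    (hφ : DifferentiableAt ℝ φ 0) (h : IsLocalMin (fun y => φ y + a * ‖y‖) 0)
    (v : EuclideanSpace ℝ (Fin n)) : -(a * ‖v‖) ≤ fderiv ℝ φ 0 v := by
  have h1 : HasDerivAt (fun t : ℝ => t • v) v 0 := by
    simpa using (hasDerivAt_id (0 : ℝ)).smul_const v
  have h2 : HasFDerivAt φ (fderiv ℝ φ 0) ((0 : ℝ) • v) := by simpa using hφ.hasFDerivAt
  have h3 : HasDerivAt (fun t : ℝ => φ (t • v)) (fderiv ℝ φ 0 v) 0 := h2.comp_hasDerivAt 0 h1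
  have hc : Tendsto (fun t : ℝ => t • v) (𝓝[>] 0) (𝓝 0) := by
    have : Continuous fun t : ℝ => t • v := by fun_prop
    simpa using (this.tendsto 0).mono_left (nhdsWithin_le_nhds (s := Set.Ioi 0))
  have h4 := h3.tendsto_slope_zero_right
  refine ge_of_tendsto h4 ?_
  filter_upwards [self_mem_nhdsWithin, hc.eventually h] with t ht0 ht
  have ht0 : 0 < t := ht0
  rw [norm_smul, Real.norm_of_nonneg ht0.le] at ht
  simp only [norm_zero, mul_zero, add_zero] at ht
  rw [zero_add, zero_smul, smul_eq_mul, inv_mul_eq_div, le_div_iff₀ ht0]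
  linarith

/-- Off the vertex the cone is smooth and `∞`-harmonic with slope `1/r`. At the vertex, contact from
above forces slope at most `1/r`, while the concave corner admits no contact from below: opposite
directional derivatives would both be negative. -/
theorem isNormalizedEigenfunction_cone {n : ℕ} (hn : 1 ≤ n) {r : ℝ} (hr : 0 < r) :
    IsNormalizedEigenfunction (Metric.ball (0 : EuclideanSpace ℝ (Fin n)) r) (cone r) where
  continuousOn := (lipschitzWith_cone hr).continuous.continuousOn
  eq_zero _ hx := cone_eq_zero_of_mem_frontier hr hx
  normalized := eLpNorm_cone hr
  subsolution := by
    intro x hx φ hφ hmax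
    have hmin : IsLocalMin (fun y => φ y - cone r y) x := by
      simpa using hmax.neg
    by_cases hx0 : x = 0
    · subst hx0
      refine (min_le_right _ _).trans ?_
      rw [dirichletEigenvalue_ball hn hr, norm_gradient]
      have hmin' : IsLocalMin (fun y => φ y + 1 / r * ‖y‖) 0 := by
        filter_upwards [hmin] with y hy
        simp only [cone, norm_zero, zero_div] at hy ⊢
        have : ‖y‖ / r = 1 / r * ‖y‖ := by ring
        linarith
      have hd := hφ.differentiableAt two_ne_zero
      have : ‖fderiv ℝ φ 0‖ ≤ 1 / r := by
        refine ContinuousLinearMap.opNorm_le_bound _ (by positivity) fun v => ?_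
        have h1 := neg_mul_norm_le_fderiv hd hmin' v
        have h2 := neg_mul_norm_le_fderiv hd hmin' (-v)
        rw [norm_neg, map_neg] at h2
        exact abs_le.2 ⟨h1, by linarith⟩
      have h0 : cone r (0 : EuclideanSpace ℝ (Fin n)) = 1 := by simp [cone]
      rw [h0]; linarith
    · refine (min_le_left _ _).trans ?_
      rw [cone_eq_radial] at hmin
      have := infLaplacian_le_of_isLocalMin hφ (contDiffAt_radial 1 (-(1 / r)) 0 hx0) hmin
      rw [infLaplacian_radial _ _ _ hx0] at this
      linarith
  supersolution := by
    intro x hx φ hφ hmin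
    by_cases hx0 : x = 0
    · exfalso
      subst hx0
      have : Nonempty (Fin n) := ⟨⟨0, hn⟩⟩
      obtain ⟨v, hv⟩ := exists_norm_eq (EuclideanSpace ℝ (Fin n)) zero_le_one
      have hmin' : IsLocalMin (fun y => -φ y + -(1 / r) * ‖y‖) 0 := by
        filter_upwards [hmin] with y hy
        simp only [cone, norm_zero, zero_div] at hy ⊢
        have : ‖y‖ / r = 1 / r * ‖y‖ := by ring
        linarith
      have hd := (hφ.differentiableAt two_ne_zero).fun_neg
      have h1 := neg_mul_norm_le_fderiv hd hmin' v
      have h2 := neg_mul_norm_le_fderiv hd hmin' (-v)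
      rw [norm_neg, map_neg] at h2
      rw [hv] at h1 h2
      have : 0 < 1 / r := by positivity
      linarith
    · have hc := (cone_mem_Icc hr hx).2
      have hmin' := hmin
      rw [cone_eq_radial] at hmin'
      have hC := contDiffAt_radial 1 (-(1 / r)) 0 hx0
      refine le_min ?_ ?_
      · have := infLaplacian_le_of_isLocalMin hC hφ hmin'
        rw [infLaplacian_radial _ _ _ hx0] at this
        linarith
      · rw [← gradient_eq_of_isLocalMin hC hφ hmin', norm_gradient_radial _ _ _ hx0,
          dirichletEigenvalue_ball hn hr, mul_zero, zero_mul, add_zero, abs_neg,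
          abs_of_pos (by positivity)]
        have : 0 < 1 / r := by positivity
        have := mul_le_mul_of_nonneg_left hc this.le
        linarith

/-! ### Bounds for eigenfunctions and uniqueness on the ball -/

theorem dirichletEigenvalue_nonneg {n : ℕ} (Ω : Set (EuclideanSpace ℝ (Fin n))) :
    0 ≤ dirichletEigenvalue Ω := by
  refine Real.sInf_nonneg ?_
  rintro t ⟨u, g, -, -, rfl⟩
  exact ENNReal.toReal_nonneg

namespace IsNormalizedEigenfunction

variable {n : ℕ} {Ω : Set (EuclideanSpace ℝ (Fin n))} {u : EuclideanSpace ℝ (Fin n) → ℝ}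

theorem abs_le_one (hΩ : IsBoundedDomain Ω) (hu : IsNormalizedEigenfunction Ω u)
    {x : EuclideanSpace ℝ (Fin n)} (hx : x ∈ Ω) : |u x| ≤ 1 := by
  have hc := hu.continuousOn.mono subset_closure
  have hm : MemLp u ⊤ (volume.restrict Ω) :=
    ⟨hc.aestronglyMeasurable hΩ.isOpen.measurableSet, by simp [hu.normalized]⟩
  simpa [hu.normalized] using abs_le_toReal_eLpNorm_top hΩ.isOpen hc hm hx

theorem nonneg (hn : 1 ≤ n) (hΩ : IsBoundedDomain Ω) (hu : IsNormalizedEigenfunction Ω u)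
    {x : EuclideanSpace ℝ (Fin n)} (hx : x ∈ closure Ω) : 0 ≤ u x := by
  by_cases h : x ∈ Ω
  · exact hu.supersolution.nonneg hn hΩ.isOpen hΩ.isBounded hu.continuousOn hu.eq_zero h
  · exact (hu.eq_zero x (hΩ.isOpen.frontier_eq ▸ ⟨hx, h⟩)).ge

theorem exists_eq_one (hn : 1 ≤ n) (hΩ : IsBoundedDomain Ω) (hu : IsNormalizedEigenfunction Ω u) :
    ∃ x ∈ Ω, u x = 1 := by
  obtain ⟨x, hx, hmax⟩ := hΩ.isBounded.isCompact_closure.exists_isMaxOn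
    hΩ.isConnected.nonempty.closure hu.continuousOn
  have h1 : 1 ≤ u x := by
    have : eLpNorm u ⊤ (volume.restrict Ω) ≤ ENNReal.ofReal (u x) := by
      rw [eLpNorm_exponent_top]
      refine eLpNormEssSup_le_of_ae_bound ?_
      filter_upwards [ae_restrict_mem hΩ.isOpen.measurableSet] with y hy
      rw [Real.norm_of_nonneg (hu.nonneg hn hΩ (subset_closure hy))]
      exact hmax (subset_closure hy)
    rw [hu.normalized] at this
    exact ENNReal.one_le_ofReal.1 this
  have hxΩ : x ∈ Ω := by
    by_contra h
    have := hu.eq_zero x (hΩ.isOpen.frontier_eq ▸ ⟨hx, h⟩)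
    linarith
  exact ⟨x, hxΩ, le_antisymm ((le_abs_self _).trans (hu.abs_le_one hΩ hxΩ)) h1⟩

theorem le_mul_norm_sub (hΩ : IsBoundedDomain Ω) (hu : IsNormalizedEigenfunction Ω u)
    {x y : EuclideanSpace ℝ (Fin n)} (hx : x ∈ Ω) (hy : y ∉ Ω) :
    u x ≤ dirichletEigenvalue Ω * ‖x - y‖ :=
  hu.subsolution.le_mul_norm_sub (dirichletEigenvalue_nonneg Ω) hΩ.isOpen hΩ.isBounded
    hu.continuousOn hu.eq_zero (fun _ hz => (le_abs_self _).trans (hu.abs_le_one hΩ hz)) hx hy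

/-- An eigenfunction dominates the cone over an inscribed ball of radius `1 / Λ`. -/
theorem exists_center (hn : 1 ≤ n) (hΩ : IsBoundedDomain Ω) (hu : IsNormalizedEigenfunction Ω u) :
    0 < dirichletEigenvalue Ω ∧ ∃ c, Metric.ball c (1 / dirichletEigenvalue Ω) ⊆ Ω ∧
      ∀ x ∈ Metric.ball c (1 / dirichletEigenvalue Ω),
        1 - dirichletEigenvalue Ω * ‖x - c‖ ≤ u x := by
  obtain ⟨c, hcΩ, hc⟩ := hu.exists_eq_one hn hΩ
  set Λ := dirichletEigenvalue Ω
  have hout : ∀ y, y ∉ Ω → 1 ≤ Λ * ‖c - y‖ := fun y hy => hc ▸ hu.le_mul_norm_sub hΩ hcΩ hy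
  -- A bounded `Ω` misses some point, where `Λ = 0` would give `1 ≤ 0`.
  have hΛ : 0 < Λ := by
    refine (dirichletEigenvalue_nonneg Ω).lt_of_ne' fun h => ?_
    have : Nonempty (Fin n) := ⟨⟨0, hn⟩⟩
    obtain ⟨y, hy⟩ := (Set.ne_univ_iff_exists_notMem Ω).1 fun h' =>
      NormedSpace.unbounded_univ ℝ (EuclideanSpace ℝ (Fin n)) (h' ▸ hΩ.isBounded)
    have h1 := hout y hy
    have h2 : Λ = 0 := h
    rw [h2, zero_mul] at h1
    linarith
  have hsub : Metric.ball c (1 / Λ) ⊆ Ω := by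
    intro y hy
    by_contra h
    have h1 := hout y h
    rw [Metric.mem_ball, dist_comm, dist_eq_norm, lt_div_iff₀ hΛ] at hy
    linarith
  refine ⟨hΛ, c, hsub, fun x hx => ?_⟩
  have := hu.supersolution.cone_le hu.continuousOn (fun x hx => hu.nonneg hn hΩ hx) hc hsub hx
  rwa [div_div_eq_mul_div, div_one, mul_comm] at this

end IsNormalizedEigenfunction

theorem isBoundedDomain_ball {n : ℕ} {r : ℝ} (hr : 0 < r) :
    IsBoundedDomain (Metric.ball (0 : EuclideanSpace ℝ (Fin n)) r) where
  isOpen := Metric.isOpen_ball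
  isConnected := (convex_ball _ _).isConnected (Metric.nonempty_ball.2 hr)
  isBounded := Metric.isBounded_ball

/-- The distance bound is exactly the cone, which equals 1 only at the origin. Hence the centre `c`
is 0, and the lower bound is the same cone. -/
theorem IsNormalizedEigenfunction.eqOn_cone {n : ℕ} (hn : 1 ≤ n) {r : ℝ} (hr : 0 < r)
    {w : EuclideanSpace ℝ (Fin n) → ℝ} (hw : IsNormalizedEigenfunction (Metric.ball 0 r) w) :
    Set.EqOn w (cone r) (Metric.ball 0 r) := by
  have hΩ := isBoundedDomain_ball (n := n) hr
  obtain ⟨-, c, hcΩ, hc⟩ := hw.exists_center hn hΩ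
  have hup : ∀ x ∈ Metric.ball (0 : EuclideanSpace ℝ (Fin n)) r, w x ≤ 1 - ‖x‖ / r := by
    intro x hx
    obtain ⟨y, hy, hxy⟩ := exists_norm_eq_and_dist_eq hn (mem_ball_zero_iff.1 hx).le
    have h := hw.le_mul_norm_sub hΩ hx (y := y) (by simp [hy])
    rw [dirichletEigenvalue_ball hn hr, hxy] at h
    refine h.trans_eq ?_
    field_simp
  rw [dirichletEigenvalue_ball hn hr, one_div_one_div] at hcΩ hc
  have hc0 : c = 0 := by
    have hcc := Metric.mem_ball_self (x := c) hr
    have h1 := hc c hcc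
    have h2 := hup c (hcΩ hcc)
    simp only [sub_self, norm_zero, mul_zero, sub_zero] at h1
    have h3 : ‖c‖ / r ≤ 0 := by linarith
    rw [div_le_iff₀ hr, zero_mul] at h3
    exact norm_le_zero_iff.1 h3
  subst hc0
  intro x hx
  refine le_antisymm (hup x hx) ?_
  have := hc x hx
  rw [sub_zero] at this
  rw [cone]
  refine le_trans (le_of_eq ?_) this
  ring

/-! ### Squeezing between balls and Hausdorff convergence -/

/-- The part of a domain outside an inscribed ball is controlled by the Neumann eigenvalue. -/
theorem norm_sub_add_le_of_ball_subset {n : ℕ} (hn : 1 ≤ n) {Ω : Set (EuclideanSpace ℝ (Fin n))}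
    (hΩ : IsBoundedDomain Ω) (hN : 0 < neumannEigenvalue Ω) {c x : EuclideanSpace ℝ (Fin n)}
    {R : ℝ} (hR : 0 < R) (hc : Metric.ball c R ⊆ Ω) (hx : x ∈ Ω) :
    ‖x - c‖ + R ≤ 2 / neumannEigenvalue Ω := by
  obtain ⟨e, he, hxe⟩ := exists_unit_direction hn (x - c)
  rw [← le_sub_iff_add_le']
  -- The ball is open, so the point opposite to `x` is taken at distance `ρ < R` from `c`.
  refine le_of_forall_lt_imp_le_of_dense fun ρ hρ => ?_
  by_cases hρ0 : ρ ≤ 0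
  · have := neumannEigenvalue_mul_norm_sub_le hΩ.isOpen hΩ.isBounded
      (hc (Metric.mem_ball_self hR)) hx
    have : ‖x - c‖ ≤ 2 / neumannEigenvalue Ω := by rwa [le_div_iff₀' hN]
    linarith
  · push Not at hρ0
    have hb : c - ρ • e ∈ Ω := hc (by
      simpa [dist_eq_norm, norm_smul, he, abs_of_pos hρ0] using hρ)
    have h1 := neumannEigenvalue_mul_norm_sub_le hΩ.isOpen hΩ.isBounded hb hx
    have h2 : x - (c - ρ • e) = (‖x - c‖ + ρ) • e := by
      rw [add_smul, ← hxe]; abel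
    rw [h2, norm_smul, he, mul_one, Real.norm_of_nonneg (by positivity), ← le_div_iff₀' hN] at h1
    linarith

theorem exists_mem_ball_dist_le {n : ℕ} {s t : ℝ} (ht : 0 < t)
    {c x : EuclideanSpace ℝ (Fin n)} (hx : x ∈ Metric.ball c s) :
    ∃ y ∈ Metric.ball c t, dist x y ≤ |s - t| := by
  have hs : 0 < s := Metric.pos_of_mem_ball hx
  rw [Metric.mem_ball, dist_eq_norm] at hx
  refine ⟨c + (t / s) • (x - c), ?_, ?_⟩
  · rw [Metric.mem_ball, dist_eq_norm, add_sub_cancel_left, norm_smul,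
      Real.norm_of_nonneg (by positivity), div_mul_eq_mul_div, div_lt_iff₀ hs]
    exact mul_lt_mul_of_pos_left hx ht
  · have : x - (c + (t / s) • (x - c)) = ((s - t) / s) • (x - c) := by
      rw [sub_div, div_self hs.ne', sub_smul, one_smul]; abel
    rw [dist_eq_norm, this, norm_smul, Real.norm_eq_abs, abs_div, abs_of_pos hs,
      div_mul_eq_mul_div, div_le_iff₀ hs]
    exact mul_le_mul_of_nonneg_left hx.le (abs_nonneg _)

section Sequence

variable {n : ℕ} {r : ℝ} {Ω : ℕ → Set (EuclideanSpace ℝ (Fin n))}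

/-- `Ω k` is squeezed between balls around `c k` whose radii tend to `r`. -/
def IsSqueezed (r : ℝ) (Ω : ℕ → Set (EuclideanSpace ℝ (Fin n)))
    (c : ℕ → EuclideanSpace ℝ (Fin n)) : Prop :=
  ∀ ε > 0, ∀ᶠ k in atTop, Metric.ball (c k) (r - ε) ⊆ Ω k ∧ Ω k ⊆ Metric.ball (c k) (r + ε)

/-- The inner radius `1/Λ` tends to `r`. The outer radius is `2/N_k - 1/Λ_k`, whose limit `2/N - r`
is at most `r` because `N ≥ 1/r`. -/
theorem isSqueezed_of_tendsto (hn : 1 ≤ n) (hr : 0 < r) (hΩ : ∀ k, IsBoundedDomain (Ω k))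
    {c : ℕ → EuclideanSpace ℝ (Fin n)} (hpos : ∀ k, 0 < dirichletEigenvalue (Ω k))
    (hc : ∀ k, Metric.ball (c k) (1 / dirichletEigenvalue (Ω k)) ⊆ Ω k)
    (hD : Tendsto (fun k => dirichletEigenvalue (Ω k)) atTop (𝓝 (1 / r))) {N : ℝ}
    (hN : Tendsto (fun k => neumannEigenvalue (Ω k)) atTop (𝓝 N)) (hrN : 1 / r ≤ N) :
    IsSqueezed r Ω c := by
  intro ε hε
  have hN0 : 0 < N := lt_of_lt_of_le (by positivity) hrN
  have hR : Tendsto (fun k => 1 / dirichletEigenvalue (Ω k)) atTop (𝓝 r) := by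
    simpa using hD.inv₀ (by positivity)
  have hS : Tendsto (fun k => 2 / neumannEigenvalue (Ω k) - 1 / dirichletEigenvalue (Ω k)) atTop
      (𝓝 (2 / N - r)) := (tendsto_const_nhds.div hN hN0.ne').sub hR
  have hSr : 2 / N - r < r + ε := by
    have : 1 / N ≤ r := by
      rw [div_le_iff₀ hN0]
      rwa [div_le_iff₀' hr] at hrN
    have h2 : 2 / N = 2 * (1 / N) := by ring
    linarith
  filter_upwards [hN.eventually (lt_mem_nhds hN0), hR.eventually (lt_mem_nhds (sub_lt_self r hε)),
    hS.eventually (gt_mem_nhds hSr)] with k h1 h2 h3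
  refine ⟨(Metric.ball_subset_ball h2.le).trans (hc k), fun x hx => ?_⟩
  have := norm_sub_add_le_of_ball_subset hn (hΩ k) h1 (one_div_pos.2 (hpos k)) (hc k) hx
  rw [Metric.mem_ball, dist_eq_norm]
  linarith

theorem IsSqueezed.tendsto_hausdorffDist (hr : 0 < r) {c : ℕ → EuclideanSpace ℝ (Fin n)}
    (h : IsSqueezed r Ω c) :
    Tendsto (fun k => Metric.hausdorffDist (Ω k) (Metric.ball (c k) r)) atTop (𝓝 0) := by
  rw [Metric.tendsto_nhds]
  intro ε hε
  set δ := min (ε / 2) (r / 2)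
  have hδ : 0 < δ := by positivity
  have hδε : δ ≤ ε / 2 := min_le_left _ _
  have hδr : δ ≤ r / 2 := min_le_right _ _
  filter_upwards [h δ hδ] with k hk
  rw [Real.dist_eq, sub_zero, abs_of_nonneg Metric.hausdorffDist_nonneg]
  refine lt_of_le_of_lt (Metric.hausdorffDist_le_of_mem_dist hδ.le ?_ ?_)
    (by linarith : δ < ε)
  · intro x hx
    obtain ⟨y, hy, hxy⟩ := exists_mem_ball_dist_le hr (hk.2 hx)
    exact ⟨y, hy, by rwa [add_sub_cancel_left, abs_of_pos hδ] at hxy⟩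
  · intro x hx
    obtain ⟨y, hy, hxy⟩ := exists_mem_ball_dist_le (t := r - δ) (by linarith) hx
    exact ⟨y, hk.1 hy, by rwa [sub_sub_cancel, abs_of_pos hδ] at hxy⟩

/-- A point of the ball around `x k` on the side away from `c k` is at distance `‖x k - c k‖ + r -
δ` from `c k`, yet within `δ` of `Ω k`, hence less than `r + 2δ` away. This leaves `‖x k - c k‖ <
3δ`. -/
theorem IsSqueezed.tendsto_norm_sub (hn : 1 ≤ n) (hr : 0 < r) {c x : ℕ → EuclideanSpace ℝ (Fin n)}
    (hΩ : ∀ k, IsBoundedDomain (Ω k)) (h : IsSqueezed r Ω c)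
    (hx : Tendsto (fun k => Metric.hausdorffDist (Ω k) (Metric.ball (x k) r)) atTop (𝓝 0)) :
    Tendsto (fun k => ‖x k - c k‖) atTop (𝓝 0) := by
  rw [Metric.tendsto_nhds]
  intro ε hε
  set δ := min (ε / 3) (r / 2)
  have hδ : 0 < δ := by positivity
  have hδε : δ ≤ ε / 3 := min_le_left _ _
  have hδr : δ ≤ r / 2 := min_le_right _ _
  filter_upwards [h δ hδ, hx.eventually (gt_mem_nhds hδ)] with k hk hxk
  rw [Real.dist_eq, sub_zero, abs_of_nonneg (norm_nonneg _)]
  obtain ⟨e, he, hxe⟩ := exists_unit_direction hn (x k - c k)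
  have hp : x k + (r - δ) • e ∈ Metric.ball (x k) r := by
    rw [Metric.mem_ball, dist_eq_norm, add_sub_cancel_left, norm_smul, he, mul_one,
      Real.norm_of_nonneg (by linarith)]
    linarith
  -- Nonemptiness and boundedness exclude an infinite Hausdorff distance, which `hausdorffDist`
  -- would report as 0.
  obtain ⟨q, hq, hqp⟩ := Metric.exists_dist_lt_of_hausdorffDist_lt' hp hxk
    (Metric.hausdorffEDist_ne_top_of_nonempty_of_bounded (hΩ k).isConnected.nonempty
      (Metric.nonempty_ball.2 hr) (hΩ k).isBounded Metric.isBounded_ball)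
  have h1 := hk.2 hq
  rw [Metric.mem_ball] at h1
  have h2 : dist (x k + (r - δ) • e) (c k) = ‖x k - c k‖ + (r - δ) := by
    have : x k + (r - δ) • e - c k = (‖x k - c k‖ + (r - δ)) • e := by
      rw [add_smul, ← hxe]; abel
    rw [dist_eq_norm, this, norm_smul, he, mul_one, Real.norm_of_nonneg]
    have := norm_nonneg (x k - c k)
    linarith
  have h3 := dist_triangle (x k + (r - δ) • e) q (c k)
  rw [dist_comm] at hqp
  linarith

theorem IsSqueezed.eventually_add_mem {c x : ℕ → EuclideanSpace ℝ (Fin n)}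
    (h : IsSqueezed r Ω c) (hxc : Tendsto (fun k => ‖x k - c k‖) atTop (𝓝 0))
    {K : Set (EuclideanSpace ℝ (Fin n))} (hK : IsCompact K) (hKr : K ⊆ Metric.ball 0 r) :
    ∀ᶠ k in atTop, ∀ y ∈ K, x k + y ∈ Ω k := by
  rcases K.eq_empty_or_nonempty with rfl | hne
  · simp
  obtain ⟨y₀, hy₀, hmax⟩ := hK.exists_isMaxOn hne continuous_norm.continuousOn
  have hρ : ‖y₀‖ < r := mem_ball_zero_iff.1 (hKr hy₀)
  set ε := (r - ‖y₀‖) / 2 with hε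
  have hε0 : 0 < ε := by linarith
  filter_upwards [h ε hε0, hxc.eventually (gt_mem_nhds hε0)] with k hk hxk y hy
  refine hk.1 ?_
  have h1 : ‖y‖ ≤ ‖y₀‖ := hmax hy
  have h2 : x k + y - c k = (x k - c k) + y := by abel
  rw [Metric.mem_ball, dist_eq_norm, h2]
  have := norm_add_le (x k - c k) y
  linarith

/-! ### Locally uniform convergence -/

theorem IsSqueezed.tendstoLocallyUniformlyOn (hn : 1 ≤ n) (hr : 0 < r)
    {c x : ℕ → EuclideanSpace ℝ (Fin n)} {u : ℕ → EuclideanSpace ℝ (Fin n) → ℝ}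
    (hΩ : ∀ k, IsBoundedDomain (Ω k)) (hu : ∀ k, IsNormalizedEigenfunction (Ω k) (u k))
    (h : IsSqueezed r Ω c) (hxc : Tendsto (fun k => ‖x k - c k‖) atTop (𝓝 0))
    (hlow : ∀ k, ∀ y ∈ Metric.ball (c k) (1 / dirichletEigenvalue (Ω k)),
      1 - dirichletEigenvalue (Ω k) * ‖y - c k‖ ≤ u k y)
    (hD : Tendsto (fun k => dirichletEigenvalue (Ω k)) atTop (𝓝 (1 / r))) :
    TendstoLocallyUniformlyOn (fun k y => u k (x k + y)) (cone r) atTop (Metric.ball 0 r) := by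
  rw [tendstoLocallyUniformlyOn_iff_forall_isCompact Metric.isOpen_ball]
  intro K hKr hK
  rw [Metric.tendstoUniformlyOn_iff]
  intro η hη
  -- With `Λ < 2/r` this gives `Λ ε ≤ η/4`. The upper error is then two such terms plus two below
  -- `η/4` coming from `|Λ r - 1|`.
  set ε := η * r / 8 with hε
  have hε0 : 0 < ε := by positivity
  have hDr : Tendsto (fun k => |dirichletEigenvalue (Ω k) * r - 1|) atTop (𝓝 0) := by
    have := ((hD.mul_const r).sub_const 1).abs
    simpa [hr.ne'] using this
  have hr2 : 1 / r < 2 / r := div_lt_div_of_pos_right one_lt_two hr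
  filter_upwards [h ε hε0, hxc.eventually (gt_mem_nhds hε0), h.eventually_add_mem hxc hK hKr,
    hDr.eventually (gt_mem_nhds (by positivity : 0 < η / 4)), hD.eventually (gt_mem_nhds hr2)]
    with k hk hxk hmem hΛr hΛ2 y hy
  have hΛ := ((hu k).exists_center hn (hΩ k)).1
  have hlow' := hlow k (x k + y)
  set Λ := dirichletEigenvalue (Ω k)
  have hp := hmem y hy
  have hyr : ‖y‖ < r := mem_ball_zero_iff.1 (hKr hy)
  have hy0 := norm_nonneg y
  have hd : |‖x k + y - c k‖ - ‖y‖| ≤ ε := by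
    refine (abs_norm_sub_norm_le _ _).trans ?_
    rw [show x k + y - c k - y = x k - c k by abel]
    exact hxk.le
  set m := ‖x k + y - c k‖
  have hΛε : Λ * ε ≤ η / 4 := by
    have := mul_le_mul_of_nonneg_right hΛ2.le hε0.le
    refine this.trans_eq ?_
    rw [hε]; field_simp; norm_num
  have hup : u k (x k + y) ≤ Λ * (r + ε - m) := by
    have hmr : m < r + ε := by simpa [dist_eq_norm] using hk.2 hp
    -- The radial projection onto the outer sphere is a point outside `Ω k` at distance `r + ε - m`.
    obtain ⟨z, hz, hmz⟩ := exists_norm_eq_and_dist_eq hn hmr.le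
    have hzΩ : c k + z ∉ Ω k := fun hzk => by
      have := hk.2 hzk
      simp [dist_eq_norm, hz] at this
    have := (hu k).le_mul_norm_sub (hΩ k) hp hzΩ
    rwa [← sub_sub, hmz] at this
  have hlow'' : 1 - Λ * m ≤ u k (x k + y) := by
    by_cases hm : x k + y ∈ Metric.ball (c k) (1 / Λ)
    · exact hlow' hm
    -- Outside the inscribed ball the lower cone is nonpositive, so nonnegativity of `u k` suffices.
    · have h1 : 0 ≤ u k (x k + y) := (hu k).nonneg hn (hΩ k) (subset_closure hp)
      have h2 : 1 / Λ ≤ m := by simpa [dist_eq_norm] using hm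
      rw [div_le_iff₀' hΛ] at h2
      linarith
  have hdm := abs_le.1 hd
  have h5 := mul_le_mul_of_nonneg_left hdm.1 hΛ.le
  have h6 := mul_le_mul_of_nonneg_left hdm.2 hΛ.le
  have h7 : |‖y‖ / r - Λ * ‖y‖| ≤ |Λ * r - 1| := by
    have : ‖y‖ / r - Λ * ‖y‖ = -(‖y‖ / r) * (Λ * r - 1) := by field_simp; ring
    rw [this, abs_mul, abs_neg, abs_of_nonneg (by positivity)]
    exact mul_le_of_le_one_left (abs_nonneg _) ((div_le_one hr).2 hyr.le)
  have h8 := abs_le.1 h7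
  have h9 := abs_lt.1 hΛr
  rw [Real.dist_eq, abs_lt, cone]
  constructor <;> linarith

end Sequence

end InfEigen

theorem corollary1p4 (n : ℕ) (hn : 1 ≤ n) (r : ℝ) (hr : 0 < r)
    (Ω : ℕ → Set (EuclideanSpace ℝ (Fin n)))
    (hΩ : ∀ k, InfEigen.IsBoundedDomain (Ω k))
    (hvol : ∀ k, volume (Ω k) = volume (Metric.ball (0 : EuclideanSpace ℝ (Fin n)) r))
    (u : ℕ → EuclideanSpace ℝ (Fin n) → ℝ)
    (hu : ∀ k, InfEigen.IsNormalizedEigenfunction (Ω k) (u k))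
    (hD : Tendsto (fun k => |InfEigen.dirichletEigenvalue (Ω k) -
      InfEigen.dirichletEigenvalue (Metric.ball (0 : EuclideanSpace ℝ (Fin n)) r)|) atTop (𝓝 0))
    (hN : Tendsto (fun k => |InfEigen.neumannEigenvalue (Ω k) -
      InfEigen.neumannEigenvalue (Metric.ball (0 : EuclideanSpace ℝ (Fin n)) r)|) atTop (𝓝 0)) :
    -- the cone is the unique normalized eigenfunction of the ball
    (InfEigen.IsNormalizedEigenfunction (Metric.ball (0 : EuclideanSpace ℝ (Fin n)) r)
        (InfEigen.cone r) ∧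
      ∀ w : EuclideanSpace ℝ (Fin n) → ℝ,
        InfEigen.IsNormalizedEigenfunction (Metric.ball 0 r) w →
          Set.EqOn w (InfEigen.cone r) (Metric.ball 0 r)) ∧
    -- up to translations, the domains converge to the ball
    (∃ x : ℕ → EuclideanSpace ℝ (Fin n),
      Tendsto (fun k => Metric.hausdorffDist (Ω k) (Metric.ball (x k) r)) atTop (𝓝 0)) ∧
    -- for all such translations, the eigenfunctions converge locally uniformly to the cone
    (∀ x : ℕ → EuclideanSpace ℝ (Fin n),
      Tendsto (fun k => Metric.hausdorffDist (Ω k) (Metric.ball (x k) r)) atTop (𝓝 0) →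
        (∀ K : Set (EuclideanSpace ℝ (Fin n)), IsCompact K → K ⊆ Metric.ball 0 r →
          ∀ᶠ k in atTop, ∀ y ∈ K, x k + y ∈ Ω k) ∧
        TendstoLocallyUniformlyOn (fun k y => u k (x k + y)) (InfEigen.cone r) atTop
          (Metric.ball 0 r)) := by

  have hD' : Tendsto (fun k => InfEigen.dirichletEigenvalue (Ω k)) atTop (𝓝 (1 / r)) := by
    rw [← InfEigen.dirichletEigenvalue_ball hn hr, tendsto_iff_dist_tendsto_zero]
    exact hD
  have hN' : Tendsto (fun k => InfEigen.neumannEigenvalue (Ω k)) atTop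
      (𝓝 (InfEigen.neumannEigenvalue (Metric.ball (0 : EuclideanSpace ℝ (Fin n)) r))) := by
    rw [tendsto_iff_dist_tendsto_zero]
    exact hN
  choose hpos c hc hlow using fun k => (hu k).exists_center hn (hΩ k)
  have hsq := InfEigen.isSqueezed_of_tendsto hn hr hΩ hpos hc hD' hN'
    (InfEigen.one_div_le_neumannEigenvalue_ball hn hr)
  refine ⟨⟨InfEigen.isNormalizedEigenfunction_cone hn hr, fun w hw => hw.eqOn_cone hn hr⟩,
    ⟨c, hsq.tendsto_hausdorffDist hr⟩, fun x hx => ?_⟩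
  have hxc := hsq.tendsto_norm_sub hn hr hΩ hx
  exact ⟨fun K hK hKr => hsq.eventually_add_mem hxc hK hKr,
    hsq.tendstoLocallyUniformlyOn hn hr hΩ hu hxc hlow hD'⟩
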